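/- **Setting.** For $n=1,2,\dots$ consider panels with $T$ periods, $N$ units and $r$ factors ($r$ fixed; $T$, $N$ and everything below may depend on $n$), $X=F^0\Lambda^{0\prime}+e$, where $F^0$ is a random $T\times r$ matrix with rows $F_t^{0\prime}$, $\Lambda^0$ is a nonrandom $N\times r$ matrix with rows $\Lambda_i^{0\prime}$, and $e=(e_{it})$ is a random $T\times N$ matrix. $\|\cdot\|$ is the Euclidean norm, and limits are for $n\to\infty$. **Assumption A** (for such a sequence of factor models). There is a constant $M<\infty$ not depending on $N,T$ with: (a) $E\|F^0_t\|^4\le M$, $\|\Lambda^0_i\|\le M$; $F^{0\prime}F^0/T\to_p\Sigma_F>0$, $\Lambda^{0\prime}\Lambda^0/N\to\Sigma_\Lambda>0$; the eigenvalues of $\Sigma_F\Sigma_\Lambda$ are distinct. (b) (i) $Ee_{it}=0$, $E|e_{it}|^8\le M$; (ii) $\sum_{t}|\gamma_N(s,t)|\le M$ for all $s$, where $\gamma_N(s,t)=E(N^{-1}\sum_i e_{it}e_{is})$; (iii) $|E(e_{it}e_{jt})|\le|\tau_{ij}|$ for all $t$, for some $\tau_{ij}$ with $\sum_j|\tau_{ij}|\le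 M$ for all $i$; (iv) $(NT)^{-1}\sum_{i,j,t,s}|E(e_{it}e_{js})|\le M$; (v) $E|N^{-1/2}\sum_i[e_{is}e_{it}-E(e_{is}e_{it})]|^4\le M$ for all $t,s$; (vi) $E\big(N^{-1}\sum_i\|T^{-1/2}\sum_tF^0_te_{it}\|^2\big)\le M$. **Missing data.** There are $N_o\le N$, $T_o\le T$ and a nonrandom pattern $\Omega_{it}\in\{0,1\}$ ($1$ = observed) with $\Omega_{it}=1$ whenever $i\le N_o$ or $t\le T_o$. The blocks are *tall* (all $t$; $i\le N_o$), *wide* ($t\le T_o$; all $i$), *bal* ($t\le T_o$, $i\le N_o$) and *miss* ($t>T_o$, $i>N_o$). **Assumption B.** Assumption A holds for each of the blocks bal, tall, wide, miss (with limit matrices of their own). Moreover $TN_o>r(T+N_o)$, $T_oN>r(T_o+N)$, $\sqrt N/\min\{N_o,T_o\}\to0$ and $\sqrt T/\min\{N_o,T_o\}\to0$. If some cells of the block miss are observed, then also, for a constant $M$ not depending on $N,T$, $E\big|N^{-1/2}\sum_{i>N_o,\ \Omega_{it}=\Omega_{is}=1}[e_{is}e_{it}-E(e_{is}e_{it})]\big|^4\le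 M$ for all $t$ and all $s>T_o$ (nothing is required if no cell of miss is observed). **Estimates.** The principal components (APC) estimates from a $T\times N$ matrix $Y$ with singular value decomposition $Y/\sqrt{NT}=UDV'$ (singular values in decreasing order) are $(\sqrt T\,U_r,\sqrt N\,V_rD_r)$, where the subscript $r$ refers to the $r$ largest singular values. Let $(\tilde F_{tall},\tilde\Lambda_{tall})$ and $(\tilde F_{wide},\tilde\Lambda_{wide})$ be APC estimates from the tall and from the wide block of $X$, let $\tilde H_{miss}=\big(\sum_{i\le N_o}\tilde\Lambda_{tall,i}\tilde\Lambda_{wide,i}'\big)\big(\sum_{i\le N_o}\tilde\Lambda_{wide,i}\tilde\Lambda_{wide,i}'\big)^{-1}$, $\tilde C_{it}=\tilde F_{tall,t}'\tilde H_{miss}\tilde\Lambda_{wide,i}$, and let $\tilde X_{it}=X_{it}$ if $\Omega_{it}=1$ and $\tilde X_{it}=\tilde C_{it}$ if $\Omega_{it}=0$. Let $(\tilde F^+,\tilde\Lambda^+)$ be APC estimates from $\tilde X$, let $\tilde D_r$ be the diagonal matrix of the $r$ largest singular values of $\tilde X/\sqrt{NT}$, and let $H^+=(\Lambda^{0\prime}\Lambda^0/N)(F^{0\prime}\tilde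 F^+/T)\tilde D_r^{-2}$. **Limits (the same as for complete data).** $\mathbb D_r^2$ is the diagonal matrix of the eigenvalues of $\Sigma_\Lambda^{1/2}\Sigma_F\Sigma_\Lambda^{1/2}$ in decreasing order, $\Upsilon$ is an orthogonal matrix of corresponding eigenvectors, and $\mathbb Q_r=\mathbb D_r\Upsilon'\Sigma_\Lambda^{-1/2}$. **Lemma 3.** Suppose that Assumption A holds for the full panels with limits $\Sigma_F,\Sigma_\Lambda$, that Assumption B holds, and that $N_o\to\infty$ and $T_o\to\infty$. Then, for every choice of the APC estimates, (i) $\frac1T\sum_{t=1}^T\|\tilde F^+_t-H^{+\prime}F^0_t\|^2=O_p\big(1/\min(N_o,T_o)\big)$; (ii) $\tilde D_r^2\to_p\mathbb D_r^2$, and $\tilde F^{+\prime}F^0/T\to_p\mathbb Q_r$ up to the signs of the columns of $\tilde F^+$: there are random diagonal matrices $S$ with diagonal entries $\pm1$ such that $S\tilde F^{+\prime}F^0/T\to_p\mathbb Q_r$. -/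

import Mathlib

open MeasureTheory Filter Topology Matrix

noncomputable section

/-! ### Convergence in probability at a rate, Euclidean norm -/

/-- `Y n = O_p(a n)`: for every `ε > 0` there is a constant `C` such that, for all large `n`,
`|Y n| > C * a n` has probability at most `ε`. -/
def IsBigOp {Ω : Type*} [MeasurableSpace Ω] (μ : Measure Ω) (Y : ℕ → Ω → ℝ) (a : ℕ → ℝ) : Prop :=
  ∀ ε : ℝ, 0 < ε → ∃ C : ℝ, ∀ᶠ n in atTop, μ {ω | C * a n < |Y n ω|} ≤ ENNReal.ofReal ε

/-- Entrywise convergence in probability of random matrices to a constant matrix. -/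
def TendstoInProb {Ω : Type*} [MeasurableSpace Ω] (μ : Measure Ω) {r : ℕ}
    (A : ℕ → Ω → Matrix (Fin r) (Fin r) ℝ) (L : Matrix (Fin r) (Fin r) ℝ) : Prop :=
  ∀ j k, TendstoInMeasure μ (fun n ω => A n ω j k) atTop (fun _ => L j k)

/-- The Euclidean norm of a vector. -/
def euclNorm {r : ℕ} (v : Fin r → ℝ) : ℝ := ‖WithLp.toLp 2 v‖

/-! ### Factor models -/

/-- The data of a `T × N` factor model with `r` factors: random factors `F` (row `t` is `F_t`),
nonrandom loadings `Λ` (row `i` is `Λ_i`), random idiosyncratic errors `e` (entry `(t, i)`). -/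
structure FactorModel (Ω : Type*) (r : ℕ) where
  T : ℕ
  N : ℕ
  F : Ω → Matrix (Fin T) (Fin r) ℝ
  Λ : Matrix (Fin N) (Fin r) ℝ
  e : Ω → Matrix (Fin T) (Fin N) ℝ

namespace FactorModel

variable {Ω : Type*} {r : ℕ}

/-- The data matrix `X = F Λ' + e`. -/
def X (m : FactorModel Ω r) (ω : Ω) : Matrix (Fin m.T) (Fin m.N) ℝ :=
  m.F ω * m.Λᵀ + m.e ω

/-- The sub-block made of selected periods and selected units. -/
def sub (m : FactorModel Ω r) {T' N' : ℕ} (f : Fin T' → Fin m.T) (g : Fin N' → Fin m.N) :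
    FactorModel Ω r where
  T := T'
  N := N'
  F := fun ω => (m.F ω).submatrix f id
  Λ := m.Λ.submatrix g id
  e := fun ω => (m.e ω).submatrix f g

end FactorModel

/-- Moment conditions on one factor model, with constant `M`. -/
structure MomentBounds {Ω : Type*} [MeasurableSpace Ω] (μ : Measure Ω) {r : ℕ} (M : ℝ)
    (m : FactorModel Ω r) : Prop where
  measurable_F : ∀ t k, Measurable fun ω => m.F ω t k
  measurable_e : ∀ t i, Measurable fun ω => m.e ω t i
  /-- `E ‖F_t‖⁴ ≤ M` -/
  integrable_F : ∀ t, Integrable (fun ω => euclNorm (m.F ω t) ^ 4) μ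
  moment_F : ∀ t, ∫ ω, euclNorm (m.F ω t) ^ 4 ∂μ ≤ M
  /-- `‖Λ_i‖ ≤ M` -/
  bound_Λ : ∀ i, euclNorm (m.Λ i) ≤ M
  /-- `E e_it = 0`, `E |e_it|⁸ ≤ M` -/
  integrable_e : ∀ t i, Integrable (fun ω => |m.e ω t i| ^ 8) μ
  mean_e : ∀ t i, ∫ ω, m.e ω t i ∂μ = 0
  moment_e : ∀ t i, ∫ ω, |m.e ω t i| ^ 8 ∂μ ≤ M
  /-- `∑_t |γ_N(s,t)| ≤ M` for all `s`, where `γ_N(s,t) = E (N⁻¹ ∑_i e_it e_is)` -/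
  serial : ∀ s, ∑ t, |∫ ω, (1 / (m.N : ℝ)) * ∑ i, m.e ω t i * m.e ω s i ∂μ| ≤ M
  /-- `|E (e_it e_jt)| ≤ |τ_ij|` for all `t`, with `∑_j |τ_ij| ≤ M` for all `i` -/
  cross : ∃ τ : Fin m.N → Fin m.N → ℝ,
    (∀ i j t, |∫ ω, m.e ω t i * m.e ω t j ∂μ| ≤ |τ i j|) ∧ ∀ i, ∑ j, |τ i j| ≤ M
  /-- `(NT)⁻¹ ∑_i ∑_j ∑_t ∑_s |E (e_it e_js)| ≤ M` -/
  joint : (1 / ((m.N : ℝ) * m.T)) *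
    ∑ i, ∑ j, ∑ t, ∑ s, |∫ ω, m.e ω t i * m.e ω s j ∂μ| ≤ M
  /-- `E |N^{-1/2} ∑_i [e_is e_it - E (e_is e_it)]|⁴ ≤ M` for all `t`, `s` -/
  fourth : ∀ t s, ∫ ω, |(1 / √(m.N : ℝ)) *
    ∑ i, (m.e ω s i * m.e ω t i - ∫ ω', m.e ω' s i * m.e ω' t i ∂μ)| ^ 4 ∂μ ≤ M
  /-- `E (N⁻¹ ∑_i ‖T^{-1/2} ∑_t F_t e_it‖²) ≤ M` -/
  factor_error : ∫ ω, (1 / (m.N : ℝ)) * ∑ i,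
    euclNorm (fun k => (1 / √(m.T : ℝ)) * ∑ t, m.F ω t k * m.e ω t i) ^ 2 ∂μ ≤ M

/-- The approximate factor model assumptions on a sequence of factor models: moment conditions
with a constant that does not depend on the sample sizes, `F'F/T → SF > 0` in probability,
`Λ'Λ/N → SΛ > 0`, and distinct eigenvalues of `SF SΛ`. -/
structure AssumptionA {Ω : Type*} [MeasurableSpace Ω] (μ : Measure Ω) {r : ℕ}
    (m : ℕ → FactorModel Ω r) (SF SΛ : Matrix (Fin r) (Fin r) ℝ) : Prop where
  moments : ∃ M : ℝ, ∀ n, MomentBounds μ M (m n)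
  posDef_F : SF.PosDef
  posDef_Λ : SΛ.PosDef
  tendsto_F : TendstoInProb μ
    (fun n ω => (1 / ((m n).T : ℝ)) • (((m n).F ω)ᵀ * (m n).F ω)) SF
  tendsto_Λ : Tendsto (fun n => (1 / ((m n).N : ℝ)) • ((m n).Λᵀ * (m n).Λ)) atTop (𝓝 SΛ)
  distinct : (SF * SΛ).charpoly.roots.Nodup

/-! ### Panels with missing data -/

/-- A factor model with an observation pattern, rearranged so that the first `No` units are
observed in all periods and all units are observed in the first `To` periods.
`obs t i = true` means that `X_it` is observed. -/
structure Panel (Ω : Type*) (r : ℕ) extends FactorModel Ω r where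
  To : ℕ
  No : ℕ
  To_le : To ≤ T
  No_le : No ≤ N
  obs : Fin T → Fin N → Bool
  obs_tall : ∀ t i, i.val < No → obs t i = true
  obs_wide : ∀ t i, t.val < To → obs t i = true

namespace Panel

variable {Ω : Type*} {r : ℕ}

/-- The first `To` periods. -/
def perO (p : Panel Ω r) : Fin p.To → Fin p.T := Fin.castLE p.To_le

/-- The first `No` units. -/
def unitO (p : Panel Ω r) : Fin p.No → Fin p.N := Fin.castLE p.No_le

/-- The remaining `T - To` periods. -/
def perM (p : Panel Ω r) : Fin (p.T - p.To) → Fin p.T := fun t => ⟨p.To + t.val, by omega⟩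

/-- The remaining `N - No` units. -/
def unitM (p : Panel Ω r) : Fin (p.N - p.No) → Fin p.N := fun i => ⟨p.No + i.val, by omega⟩

/-- The balanced block. -/
def bal (p : Panel Ω r) : FactorModel Ω r := p.toFactorModel.sub p.perO p.unitO

/-- The tall block: all periods, the first `No` units. -/
def tall (p : Panel Ω r) : FactorModel Ω r := p.toFactorModel.sub id p.unitO

/-- The wide block: the first `To` periods, all units. -/
def wide (p : Panel Ω r) : FactorModel Ω r := p.toFactorModel.sub p.perO id

/-- The block with the missing data. -/
def miss (p : Panel Ω r) : FactorModel Ω r := p.toFactorModel.sub p.perM p.unitM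

end Panel

/-- The assumptions on the sub-blocks of a sequence of panels. -/
structure AssumptionB {Ω : Type*} [MeasurableSpace Ω] (μ : Measure Ω) {r : ℕ}
    (p : ℕ → Panel Ω r) : Prop where
  bal : ∃ SF SΛ, AssumptionA μ (fun n => (p n).bal) SF SΛ
  tall : ∃ SF SΛ, AssumptionA μ (fun n => (p n).tall) SF SΛ
  wide : ∃ SF SΛ, AssumptionA μ (fun n => (p n).wide) SF SΛ
  miss : ∃ SF SΛ, AssumptionA μ (fun n => (p n).miss) SF SΛ
  order_tall : ∀ n, r * ((p n).T + (p n).No) < (p n).T * (p n).No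
  order_wide : ∀ n, r * ((p n).To + (p n).N) < (p n).To * (p n).N
  rate_N : Tendsto (fun n => √((p n).N : ℝ) / (min (p n).No (p n).To : ℕ)) atTop (𝓝 0)
  rate_T : Tendsto (fun n => √((p n).T : ℝ) / (min (p n).No (p n).To : ℕ)) atTop (𝓝 0)
  /-- The fourth-moment condition for the units `i ≥ No` that are observed both in a period
  `s ≥ To` and in a period `t`. The sum is empty, so that nothing is required, when no cell of
  the block `miss` is observed. -/
  fourth_obs : ∃ M : ℝ, ∀ n, ∀ t s : Fin (p n).T, (p n).To ≤ s.val →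
    ∫ ω, |(1 / √((p n).N : ℝ)) *
      ∑ i with (p n).No ≤ i.val ∧ (p n).obs t i = true ∧ (p n).obs s i = true,
        ((p n).e ω s i * (p n).e ω t i - ∫ ω', (p n).e ω' s i * (p n).e ω' t i ∂μ)| ^ 4 ∂μ ≤ M

/-! ### Asymptotic principal components and the tall-wide imputation -/

/-- `Z = U diag(s) V'` is a (thin) singular value decomposition, with the singular values in
decreasing order. -/
structure IsSVD {T N : ℕ} (Z : Matrix (Fin T) (Fin N) ℝ) (U : Matrix (Fin T) (Fin (min T N)) ℝ)
    (s : Fin (min T N) → ℝ) (V : Matrix (Fin N) (Fin (min T N)) ℝ) : Prop where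
  orth_U : Uᵀ * U = 1
  orth_V : Vᵀ * V = 1
  antitone : Antitone s
  nonneg : ∀ k, 0 ≤ s k
  eq : Z = U * diagonal s * Vᵀ

/-- `(Fh, Lh) = (√T U_r, √N V_r D_r)` are principal components estimates with `r` factors from
the `T × N` matrix `Y`, and `d` lists the `r` largest singular values `D_r`; here
`Y / √(NT) = U D V'` is a singular value decomposition. -/
def IsAPC {T N r : ℕ} (Y : Matrix (Fin T) (Fin N) ℝ) (Fh : Matrix (Fin T) (Fin r) ℝ)
    (Lh : Matrix (Fin N) (Fin r) ℝ) (d : Fin r → ℝ) : Prop :=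
  ∃ U s V, IsSVD ((1 / √((N : ℝ) * T)) • Y) U s V ∧ ∃ h : r ≤ min T N,
    Fh = √(T : ℝ) • U.submatrix id (Fin.castLE h) ∧
    Lh = √(N : ℝ) • (V.submatrix id (Fin.castLE h) * diagonal (s ∘ Fin.castLE h)) ∧
    d = s ∘ Fin.castLE h

/-- Principal components estimates from the tall and from the wide block, at the outcome `ω`. -/
structure TallWide {Ω : Type*} {r : ℕ} (p : Panel Ω r) (ω : Ω) where
  Ftall : Matrix (Fin p.T) (Fin r) ℝ
  Λtall : Matrix (Fin p.No) (Fin r) ℝ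
  dtall : Fin r → ℝ
  isAPC_tall : IsAPC ((p.X ω).submatrix id p.unitO) Ftall Λtall dtall
  Fwide : Matrix (Fin p.To) (Fin r) ℝ
  Λwide : Matrix (Fin p.N) (Fin r) ℝ
  dwide : Fin r → ℝ
  isAPC_wide : IsAPC ((p.X ω).submatrix p.perO id) Fwide Λwide dwide

namespace TallWide

variable {Ω : Type*} {r : ℕ} {p : Panel Ω r} {ω : Ω}

/-- The `No × r` sub-matrix of the loadings estimated from the wide block. -/
def Λwo (q : TallWide p ω) : Matrix (Fin p.No) (Fin r) ℝ := q.Λwide.submatrix p.unitO id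

/-- The coefficient matrix of the regression of `Λtall,i` on `Λwide,i`, `i ≤ No`:
`(∑ Λtall,i Λwide,i') (∑ Λwide,i Λwide,i')⁻¹`. -/
def Hmiss (q : TallWide p ω) : Matrix (Fin r) (Fin r) ℝ :=
  (q.Λtallᵀ * q.Λwo) * (q.Λwoᵀ * q.Λwo)⁻¹

/-- The imputed common components `Ftall Hmiss Λwide'`. -/
def C (q : TallWide p ω) : Matrix (Fin p.T) (Fin p.N) ℝ := q.Ftall * q.Hmiss * q.Λwideᵀ

/-- The imputed data matrix: the data where observed, the common component elsewhere. -/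
def imputed (q : TallWide p ω) : Matrix (Fin p.T) (Fin p.N) ℝ :=
  Matrix.of fun t i => if p.obs t i = true then p.X ω t i else q.C t i

end TallWide

/-- Principal components estimates from the imputed data matrix, at the outcome `ω`. -/
structure ReEstimate {Ω : Type*} {r : ℕ} (p : Panel Ω r) (ω : Ω) extends TallWide p ω where
  Fplus : Matrix (Fin p.T) (Fin r) ℝ
  Λplus : Matrix (Fin p.N) (Fin r) ℝ
  dplus : Fin r → ℝ
  isAPC_plus : IsAPC toTallWide.imputed Fplus Λplus dplus

/-- The rotation matrix `H⁺ = (Λ'Λ/N) (F'F⁺/T) D⁻²`. -/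
def ReEstimate.Hplus {Ω : Type*} {r : ℕ} {p : Panel Ω r} {ω : Ω} (q : ReEstimate p ω) :
    Matrix (Fin r) (Fin r) ℝ :=
  ((1 / (p.N : ℝ)) • (p.Λᵀ * p.Λ)) * ((1 / (p.T : ℝ)) • ((p.F ω)ᵀ * q.Fplus)) *
    diagonal fun k => (q.dplus k ^ 2)⁻¹

/-- `v` lists the eigenvalues of `SΛ^{1/2} SF SΛ^{1/2}` in decreasing order, and
`Q = 𝔻 Υ' SΛ^{-1/2}`, where `𝔻² = diag(v)` and the columns of `Υ` are corresponding orthonormal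
eigenvectors. Here `S = SΛ^{1/2}`. -/
def IsCompleteDataLimit {r : ℕ} (SF SΛ : Matrix (Fin r) (Fin r) ℝ) (v : Fin r → ℝ)
    (Q : Matrix (Fin r) (Fin r) ℝ) : Prop :=
  ∃ S Υ : Matrix (Fin r) (Fin r) ℝ, S.PosDef ∧ S * S = SΛ ∧ Υᵀ * Υ = 1 ∧ Antitone v ∧
    (S * SF * S) * Υ = Υ * diagonal v ∧ Q = (diagonal fun k => √(v k)) * Υᵀ * S⁻¹

end

/-! Scale everything: `f = F⁰/√T`, `l = Λ⁰/√N`, `b = lᵀ l`, `u = F̃⁺/√T`, `x = X̃/√(NT)`, and let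
`ρ` be `min(No, To)^(-1/2)`. All approximations below are in Frobenius norm, with error `O_p(ρ)`.

Suppose that `x xᵀ ≈ f b fᵀ` (`FactorApprox`). A dimension count in the style of Courant and Fischer
keeps the `r` leading singular values away from zero with probability tending to one
(`IsPC.exists_lower_bound`). Hence the eigenvector equation `x xᵀ u = u D²` can be divided by `D²`,
which gives `u ≈ f H` with `H = b fᵀ u D⁻²` (`FactorApprox.near_u`). This `H` is exactly `H⁺`, and
squaring the Frobenius distance gives (i).

For (ii), `G = fᵀ u` satisfies `G D² ≈ fᵀf b G` and `D² ≈ Gᵀ b G`. Events of probability tending to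
one form a filter, and along every ultrafilter finer than it the bounded matrices `G` converge. The
limit solves the exact equations, which determine `D²`, and `G` up to the signs of its columns,
because the eigenvalues of `Σ_F Σ_Λ` are distinct (`IsCompleteDataLimit.eq_of_eigen`). No
perturbation theory of eigenvectors is needed.

It remains to prove `x xᵀ ≈ f b fᵀ` for the imputed data. Write `x = f lᵀ + ε`, where `ε` is the
scaled error on the observed cells and the scaled imputation error on the others. It is enough that
`ε l` and `ε εᵀ` are `O_p(ρ)` (`near_of_error`). On the observed cells this follows from second
moments (`MomentBounds.integral_frob_mask_mul_load_le`,
`MomentBounds.integral_frob_mask_mul_transpose_le`). For the imputation error, the tall and wide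
blocks are complete panels, so the theory above applies to each: factors are near `f H`, loadings
near `l G`, and `H Gᵀ ≈ 1`. The regression coefficient is near `Gₜᵀ H_w`, so the rotations cancel in
the imputed component and it is near `f lᵀ` (`near_imputed`). -/

/-! ### The Frobenius norm of rectangular matrices -/

section Frobenius

variable {m n k : Type*} [Fintype m] [Fintype n] [Fintype k]

/-- The Frobenius norm of a real matrix. -/
noncomputable def frob (A : Matrix m n ℝ) : ℝ := √(∑ i, ∑ j, A i j ^ 2)

lemma frob_nonneg (A : Matrix m n ℝ) : 0 ≤ frob A := Real.sqrt_nonneg _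

lemma frob_sq (A : Matrix m n ℝ) : frob A ^ 2 = ∑ i, ∑ j, A i j ^ 2 :=
  Real.sq_sqrt (Finset.sum_nonneg fun _ _ => Finset.sum_nonneg fun _ _ => sq_nonneg _)

section
attribute [local instance] Matrix.frobeniusSeminormedAddCommGroup

lemma frob_eq_norm (A : Matrix m n ℝ) : frob A = ‖A‖ := by
  rw [Matrix.frobenius_norm_def, frob, Real.sqrt_eq_rpow]
  simp

lemma frob_add_le (A B : Matrix m n ℝ) : frob (A + B) ≤ frob A + frob B := by
  simp only [frob_eq_norm]
  exact norm_add_le _ _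

lemma frob_mul_le (A : Matrix m n ℝ) (B : Matrix n k ℝ) : frob (A * B) ≤ frob A * frob B := by
  simp only [frob_eq_norm]
  exact Matrix.frobenius_norm_mul _ _
end

@[simp] lemma frob_transpose (A : Matrix m n ℝ) : frob Aᵀ = frob A := by
  rw [frob, frob, Finset.sum_comm]
  rfl

@[simp] lemma frob_neg (A : Matrix m n ℝ) : frob (-A) = frob A := by simp [frob]

lemma frob_smul (c : ℝ) (A : Matrix m n ℝ) : frob (c • A) = |c| * frob A := by
  simp only [frob, Matrix.smul_apply, smul_eq_mul, mul_pow, ← Finset.mul_sum]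
  rw [Real.sqrt_mul (sq_nonneg c), Real.sqrt_sq_eq_abs]

lemma frob_mono {A B : Matrix m n ℝ} (h : ∀ i j, |A i j| ≤ |B i j|) : frob A ≤ frob B :=
  Real.sqrt_le_sqrt (Finset.sum_le_sum fun i _ => Finset.sum_le_sum fun j _ =>
    sq_le_sq.2 (h i j))

lemma abs_apply_le_frob (A : Matrix m n ℝ) (i : m) (j : n) : |A i j| ≤ frob A := by
  refine Real.le_sqrt_of_sq_le ?_
  rw [sq_abs]
  calc A i j ^ 2 ≤ ∑ j, A i j ^ 2 :=
        Finset.single_le_sum (f := fun j => A i j ^ 2) (fun _ _ => sq_nonneg _) (Finset.mem_univ j)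
    _ ≤ _ := Finset.single_le_sum (f := fun i => ∑ j, A i j ^ 2)
        (fun _ _ => Finset.sum_nonneg fun _ _ => sq_nonneg _) (Finset.mem_univ i)

lemma frob_sq_eq_trace (A : Matrix m n ℝ) : frob A ^ 2 = (Aᵀ * A).trace := by
  rw [frob_sq, Finset.sum_comm]
  simp [Matrix.trace, Matrix.mul_apply, sq]

/-- Cauchy–Schwarz over pairs of indices: the quadratic form is the inner product of `A` with `v
vᵀ`, whose Frobenius norm is `v ⬝ᵥ v`. -/
lemma abs_dotProduct_mulVec_le_frob (A : Matrix m m ℝ) (v : m → ℝ) :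
    |v ⬝ᵥ (A *ᵥ v)| ≤ frob A * (v ⬝ᵥ v) := by
  have hv : 0 ≤ v ⬝ᵥ v := Finset.sum_nonneg fun i _ => mul_self_nonneg _
  refine abs_le_of_sq_le_sq ?_ (mul_nonneg (frob_nonneg A) hv)
  have h1 : v ⬝ᵥ (A *ᵥ v) = ∑ p : m × m, A p.1 p.2 * (v p.1 * v p.2) := by
    rw [Fintype.sum_prod_type]
    simp only [dotProduct, mulVec, Finset.mul_sum]
    exact Finset.sum_congr rfl fun i _ => Finset.sum_congr rfl fun j _ => by ring
  have h2 : (v ⬝ᵥ v) ^ 2 = ∑ p : m × m, (v p.1 * v p.2) ^ 2 := by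
    rw [Fintype.sum_prod_type, sq, dotProduct, Finset.sum_mul_sum]
    exact Finset.sum_congr rfl fun i _ => Finset.sum_congr rfl fun j _ => by ring
  have h3 : frob A ^ 2 = ∑ p : m × m, A p.1 p.2 ^ 2 := by
    rw [Fintype.sum_prod_type, frob_sq]
  rw [mul_pow, h1, h2, h3]
  exact Finset.sum_mul_sq_le_sq_mul_sq _ _ _

lemma mulVec_dotProduct_self_le (A : Matrix m n ℝ) (v : n → ℝ) :
    (A *ᵥ v) ⬝ᵥ (A *ᵥ v) ≤ frob A ^ 2 * (v ⬝ᵥ v) := by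
  rw [frob_sq, Finset.sum_mul]
  refine Finset.sum_le_sum fun i _ => ?_
  have := Finset.sum_mul_sq_le_sq_mul_sq Finset.univ (A i) v
  simpa [dotProduct, mulVec, sq] using this

/-- A positive definite matrix is bounded below. -/
lemma Matrix.PosDef.exists_lower_bound [DecidableEq n] {A : Matrix n n ℝ} (hA : A.PosDef) :
    ∃ α > 0, ∀ z : n → ℝ, α * (z ⬝ᵥ z) ≤ z ⬝ᵥ (A *ᵥ z) := by
  open scoped MatrixOrder in
  obtain ⟨S, hS⟩ := CStarAlgebra.nonneg_iff_eq_star_mul_self.1 hA.posSemidef.nonneg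
  rw [star_eq_conjTranspose] at hS
  have hSu : IsUnit S := by
    have h := hA.isUnit
    rw [Matrix.isUnit_iff_isUnit_det] at h ⊢
    rw [hS, det_mul] at h
    exact isUnit_of_mul_isUnit_right h
  -- With `A = SᵀS`, the bound `‖z‖ ≤ ‖S⁻¹‖ ‖S z‖` would give the constant `‖S⁻¹‖⁻²`; the added `1`
  -- also covers an empty index type, where the norm is zero.
  refine ⟨1 / (1 + frob S⁻¹ ^ 2), by positivity, fun z => ?_⟩
  have h1 : z ⬝ᵥ (A *ᵥ z) = (S *ᵥ z) ⬝ᵥ (S *ᵥ z) := by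
    rw [hS, ← mulVec_mulVec, dotProduct_mulVec, conjTranspose_eq_transpose_of_trivial,
      vecMul_transpose]
  have h2 : z = S⁻¹ *ᵥ (S *ᵥ z) := by
    rw [mulVec_mulVec, nonsing_inv_mul _ ((Matrix.isUnit_iff_isUnit_det _).1 hSu), one_mulVec]
  have h3 := mulVec_dotProduct_self_le S⁻¹ (S *ᵥ z)
  rw [← h2] at h3
  have h4 : 0 ≤ (S *ᵥ z) ⬝ᵥ (S *ᵥ z) := Finset.sum_nonneg fun i _ => mul_self_nonneg _
  rw [h1, div_mul_eq_mul_div, div_le_iff₀ (by positivity)]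
  nlinarith

end Frobenius

section FrobeniusTendsto

lemma tendsto_matrix_iff {ι m n : Type*} {l : Filter ι} {A : ι → Matrix m n ℝ}
    {A₀ : Matrix m n ℝ} : Tendsto A l (𝓝 A₀) ↔ ∀ i j, Tendsto (fun k => A k i j) l (𝓝 (A₀ i j)) :=
  tendsto_pi_nhds.trans (forall_congr' fun _ => tendsto_pi_nhds)

variable {ι m n : Type*} [Fintype m] [Fintype n]

lemma tendsto_frob_sub {l : Filter ι} {A : ι → Matrix m n ℝ} {A₀ : Matrix m n ℝ}
    (h : Tendsto A l (𝓝 A₀)) : Tendsto (fun i => frob (A i - A₀)) l (𝓝 0) := by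
  have h1 : Continuous fun B : Matrix m n ℝ => frob (B - A₀) := by
    unfold frob
    fun_prop
  simpa [Function.comp_def, frob] using (h1.tendsto A₀).comp h

lemma tendsto_frob {l : Filter ι} {A : ι → Matrix m n ℝ} {A₀ : Matrix m n ℝ}
    (h : Tendsto A l (𝓝 A₀)) : Tendsto (fun i => frob (A i)) l (𝓝 (frob A₀)) := by
  have h1 : Continuous fun B : Matrix m n ℝ => frob B := by
    unfold frob
    fun_prop
  exact (h1.tendsto A₀).comp h

lemma tendsto_of_frob_sub {l : Filter ι} {A : ι → Matrix m n ℝ} {A₀ : Matrix m n ℝ}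
    (h : Tendsto (fun i => frob (A i - A₀)) l (𝓝 0)) : Tendsto A l (𝓝 A₀) := by
  rw [tendsto_matrix_iff]
  intro i j
  rw [tendsto_iff_norm_sub_tendsto_zero]
  exact squeeze_zero (fun _ => norm_nonneg _) (fun k => abs_apply_le_frob (A k - A₀) i j) h

end FrobeniusTendsto

/-! ### The filter of events whose probability tends to one -/

section ProbFilter

variable {Ω : Type*} [MeasurableSpace Ω] {μ : Measure Ω}

/-- The families of events whose complements have outer measure tending to zero. -/
def probFilter (μ : Measure Ω) : Filter (ℕ × Ω) where
  sets := {S | Tendsto (fun n => μ {ω | (n, ω) ∉ S}) atTop (𝓝 0)}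
  univ_sets := by simp
  sets_of_superset := by
    intro S S' h hS
    refine tendsto_of_tendsto_of_tendsto_of_le_of_le tendsto_const_nhds h (fun _ => zero_le) ?_
    exact fun n => measure_mono fun ω hω hS' => hω (hS hS')
  -- Only monotonicity and subadditivity of the outer measure enter, so the events need not be
  -- measurable. This matters because the estimates are arbitrary choices at each outcome.
  inter_sets := by
    intro S S' h h'
    have h2 : Tendsto (fun n => μ {ω | (n, ω) ∉ S} + μ {ω | (n, ω) ∉ S'}) atTop (𝓝 0) := by
      simpa using Tendsto.add h h'
    refine tendsto_of_tendsto_of_tendsto_of_le_of_le tendsto_const_nhds h2 (fun _ => zero_le) ?_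
    intro n
    refine (measure_mono ?_).trans (measure_union_le _ _)
    intro ω hω
    by_contra hc
    simp only [Set.mem_union, Set.mem_ofPred_eq, not_or, not_not] at hc
    exact hω ⟨hc.1, hc.2⟩

lemma eventually_probFilter {P : ℕ → Ω → Prop} :
    (∀ᶠ i in probFilter μ, P i.1 i.2) ↔ Tendsto (fun n => μ {ω | ¬ P n ω}) atTop (𝓝 0) :=
  Iff.rfl

lemma eventually_probFilter_of_forall {P : ℕ → Ω → Prop} (h : ∀ᶠ n in atTop, ∀ ω, P n ω) :
    ∀ᶠ i in probFilter μ, P i.1 i.2 := by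
  rw [eventually_probFilter]
  refine tendsto_const_nhds.congr' ?_
  filter_upwards [h] with n hn
  simp [hn]

lemma tendsto_fst_probFilter : Tendsto Prod.fst (probFilter μ) atTop := fun S hS =>
  eventually_probFilter_of_forall (P := fun n _ => n ∈ S)
    (by filter_upwards [hS] with n hn _ using hn)

/-- Turns convergence in probability into convergence along a filter, so that continuity, the
algebra of limits and ultrafilters become available. -/
lemma tendstoInMeasure_iff_probFilter {Y : ℕ → Ω → ℝ} {c : ℝ} :
    TendstoInMeasure μ Y atTop (fun _ => c) ↔
      Tendsto (fun i : ℕ × Ω => Y i.1 i.2) (probFilter μ) (𝓝 c) := by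
  rw [tendstoInMeasure_iff_dist, Metric.tendsto_nhds]
  refine forall₂_congr fun ε hε => ?_
  rw [eventually_probFilter (P := fun n ω => dist (Y n ω) c < ε)]
  simp only [not_lt]

lemma tendstoInProb_iff_probFilter {r : ℕ} {A : ℕ → Ω → Matrix (Fin r) (Fin r) ℝ}
    {L : Matrix (Fin r) (Fin r) ℝ} :
    TendstoInProb μ A L ↔ Tendsto (fun i : ℕ × Ω => A i.1 i.2) (probFilter μ) (𝓝 L) := by
  rw [tendsto_matrix_iff]
  exact forall₂_congr fun j k => tendstoInMeasure_iff_probFilter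

end ProbFilter

/-! ### Calculus of stochastic orders -/

namespace IsBigOp

variable {Ω : Type*} [MeasurableSpace Ω] {μ : Measure Ω} {Y Z : ℕ → Ω → ℝ} {a b : ℕ → ℝ}

/-- The comparison is needed only with probability tending to one: half of `ε` pays for the event
where it fails. -/
lemma mono (hZ : IsBigOp μ Z a) (h : ∀ᶠ i in probFilter μ, |Y i.1 i.2| ≤ |Z i.1 i.2|) :
    IsBigOp μ Y a := by
  intro ε hε
  obtain ⟨C, hC⟩ := hZ (ε / 2) (half_pos hε)
  refine ⟨C, ?_⟩
  have h1 := (eventually_probFilter (P := fun n ω => |Y n ω| ≤ |Z n ω|)).1 h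
  have h2 := h1.eventually (gt_mem_nhds (ENNReal.ofReal_pos.2 (half_pos hε)))
  filter_upwards [hC, h2] with n hn hn2
  calc μ {ω | C * a n < |Y n ω|}
      ≤ μ ({ω | C * a n < |Z n ω|} ∪ {ω | ¬ |Y n ω| ≤ |Z n ω|}) := by
        refine measure_mono fun ω hω => ?_
        by_cases hc : |Y n ω| ≤ |Z n ω|
        · exact Or.inl (lt_of_lt_of_le hω hc)
        · exact Or.inr hc
    _ ≤ _ := measure_union_le _ _
    _ ≤ ENNReal.ofReal (ε / 2) + ENNReal.ofReal (ε / 2) := add_le_add hn hn2.le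
    _ = ENNReal.ofReal ε := by
        rw [← ENNReal.ofReal_add (half_pos hε).le (half_pos hε).le, add_halves]

lemma add (hY : IsBigOp μ Y a) (hZ : IsBigOp μ Z a) :
    IsBigOp μ (fun n ω => Y n ω + Z n ω) a := by
  intro ε hε
  obtain ⟨C, hC⟩ := hY (ε / 2) (half_pos hε)
  obtain ⟨D, hD⟩ := hZ (ε / 2) (half_pos hε)
  refine ⟨C + D, ?_⟩
  filter_upwards [hC, hD] with n hn hn2
  calc μ {ω | (C + D) * a n < |Y n ω + Z n ω|}
      ≤ μ ({ω | C * a n < |Y n ω|} ∪ {ω | D * a n < |Z n ω|}) := by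
        refine measure_mono fun ω hω => ?_
        by_contra hc
        simp only [Set.mem_union, Set.mem_ofPred_eq, not_or, not_lt] at hc hω
        have := abs_add_le (Y n ω) (Z n ω)
        nlinarith
    _ ≤ _ := measure_union_le _ _
    _ ≤ ENNReal.ofReal (ε / 2) + ENNReal.ofReal (ε / 2) := add_le_add hn hn2
    _ = ENNReal.ofReal ε := by
        rw [← ENNReal.ofReal_add (half_pos hε).le (half_pos hε).le, add_halves]

lemma mul (ha : ∀ n, 0 ≤ a n) (hb : ∀ n, 0 ≤ b n) (hY : IsBigOp μ Y a) (hZ : IsBigOp μ Z b) :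
    IsBigOp μ (fun n ω => Y n ω * Z n ω) (fun n => a n * b n) := by
  intro ε hε
  obtain ⟨C, hC⟩ := hY (ε / 2) (half_pos hε)
  obtain ⟨D, hD⟩ := hZ (ε / 2) (half_pos hε)
  -- The constants in `IsBigOp` may be negative, so absolute values are taken before the two bounds
  -- are multiplied.
  refine ⟨|C| * |D|, ?_⟩
  filter_upwards [hC, hD] with n hn hn2
  calc μ {ω | (|C| * |D|) * (a n * b n) < |Y n ω * Z n ω|}
      ≤ μ ({ω | C * a n < |Y n ω|} ∪ {ω | D * b n < |Z n ω|}) := by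
        refine measure_mono fun ω hω => ?_
        by_contra hc
        simp only [Set.mem_union, Set.mem_ofPred_eq, not_or, not_lt, abs_mul] at hc hω
        have h1 : |Y n ω| ≤ |C| * a n :=
          hc.1.trans (mul_le_mul_of_nonneg_right (le_abs_self C) (ha n))
        have h2 : |Z n ω| ≤ |D| * b n :=
          hc.2.trans (mul_le_mul_of_nonneg_right (le_abs_self D) (hb n))
        have := mul_le_mul h1 h2 (abs_nonneg _) (mul_nonneg (abs_nonneg C) (ha n))
        nlinarith
    _ ≤ _ := measure_union_le _ _
    _ ≤ ENNReal.ofReal (ε / 2) + ENNReal.ofReal (ε / 2) := add_le_add hn hn2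
    _ = ENNReal.ofReal ε := by
        rw [← ENNReal.ofReal_add (half_pos hε).le (half_pos hε).le, add_halves]

lemma rate_mono (hY : IsBigOp μ Y a) (ha : ∀ᶠ n in atTop, 0 ≤ a n)
    (hab : ∀ᶠ n in atTop, a n ≤ b n) : IsBigOp μ Y b := by
  intro ε hε
  obtain ⟨C, hC⟩ := hY ε hε
  refine ⟨|C|, ?_⟩
  filter_upwards [hC, ha, hab] with n hn h1 h2
  refine (measure_mono fun ω hω => ?_).trans hn
  exact lt_of_le_of_lt ((mul_le_mul_of_nonneg_right (le_abs_self C) h1).trans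
    (mul_le_mul_of_nonneg_left h2 (abs_nonneg C))) hω

lemma tendsto_zero (hY : IsBigOp μ Y a) (ha : Tendsto a atTop (𝓝 0)) :
    Tendsto (fun i : ℕ × Ω => Y i.1 i.2) (probFilter μ) (𝓝 0) := by
  rw [Metric.tendsto_nhds]
  intro η hη
  refine (eventually_probFilter (P := fun n ω => dist (Y n ω) 0 < η)).2 ?_
  rw [ENNReal.tendsto_nhds_zero]
  intro ε hε
  rcases eq_or_ne ε ⊤ with rfl | hε'
  · simp
  obtain ⟨C, hC⟩ := hY ε.toReal (ENNReal.toReal_pos hε.ne' hε')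
  have h1 : Tendsto (fun n => C * a n) atTop (𝓝 0) := by simpa using ha.const_mul C
  filter_upwards [hC, h1.eventually (gt_mem_nhds hη)] with n hn h2
  rw [ENNReal.ofReal_toReal hε'] at hn
  refine (measure_mono fun ω hω => ?_).trans hn
  simp only [Real.dist_eq, sub_zero, not_lt, Set.mem_ofPred_eq] at hω ⊢
  exact lt_of_lt_of_le h2 hω

lemma of_tendsto {c : ℝ} (h : Tendsto (fun i : ℕ × Ω => Y i.1 i.2) (probFilter μ) (𝓝 c)) :
    IsBigOp μ Y fun _ => 1 := by
  intro ε hε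
  refine ⟨|c| + 1, ?_⟩
  have h1 : ∀ᶠ i in probFilter μ, |Y i.1 i.2| ≤ |c| + 1 := by
    filter_upwards [h.abs.eventually (gt_mem_nhds (lt_add_one |c|))] with i hi using hi.le
  have h2 := (eventually_probFilter (P := fun n ω => |Y n ω| ≤ |c| + 1)).1 h1
  filter_upwards [h2.eventually (gt_mem_nhds (ENNReal.ofReal_pos.2 hε))] with n hn
  simpa using hn.le

lemma const (c : ℝ) : IsBigOp μ (fun _ _ => c) fun _ => 1 :=
  of_tendsto tendsto_const_nhds

/-- A bound in probability from a bound on second moments. -/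
lemma of_integral_sq [IsFiniteMeasure μ] {K : ℝ} (ha : ∀ᶠ n in atTop, 0 < a n)
    (hint : ∀ᶠ n in atTop, Integrable (fun ω => Y n ω ^ 2) μ)
    (hK : ∀ᶠ n in atTop, ∫ ω, Y n ω ^ 2 ∂μ ≤ K * a n ^ 2) : IsBigOp μ Y a := by
  intro ε hε
  -- Chebyshev's inequality at the threshold `c * a n` with `c² = (|K| + 1) / ε`, which leaves
  -- probability at most `K / c² ≤ ε`; `|K| + 1` keeps `c` positive for every `K`.
  have hC : 0 < √((|K| + 1) / ε) := by positivity
  refine ⟨√((|K| + 1) / ε), ?_⟩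
  filter_upwards [ha, hint, hK] with n h1 h2 h3
  set c := √((|K| + 1) / ε)
  have hc : c ^ 2 = (|K| + 1) / ε := Real.sq_sqrt (by positivity)
  have h4 := mul_meas_ge_le_integral_of_nonneg (ae_of_all μ fun ω => sq_nonneg (Y n ω)) h2
    ((c * a n) ^ 2)
  have h5 : μ.real {ω | (c * a n) ^ 2 ≤ Y n ω ^ 2} ≤ ε := by
    have h6 : 0 < a n ^ 2 := by positivity
    have h7 : (|K| + 1) / ε * a n ^ 2 * μ.real {ω | (c * a n) ^ 2 ≤ Y n ω ^ 2} ≤ K * a n ^ 2 := by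
      rw [← hc, ← mul_pow]
      exact h4.trans h3
    have h8 : (|K| + 1) / ε * μ.real {ω | (c * a n) ^ 2 ≤ Y n ω ^ 2} ≤ |K| + 1 := by
      have := le_abs_self K
      by_contra hcon
      push Not at hcon
      nlinarith
    rw [div_mul_eq_mul_div, div_le_iff₀ hε] at h8
    exact le_of_mul_le_mul_left h8 (by positivity)
  refine (measure_mono fun ω hω => ?_).trans
    ((ENNReal.le_ofReal_iff_toReal_le (measure_ne_top _ _) hε.le).2 h5)
  simp only [Set.mem_ofPred_eq] at hω ⊢
  rw [← sq_abs (Y n ω)]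
  exact pow_le_pow_left₀ (by positivity) hω.le 2

end IsBigOp

/-! ### Principal components of a matrix -/

/-- The columns of `u` are left singular vectors of `x` for its largest singular values `d`. -/
structure IsPC {T N r : ℕ} (x : Matrix (Fin T) (Fin N) ℝ) (u : Matrix (Fin T) (Fin r) ℝ)
    (d : Fin r → ℝ) : Prop where
  orth : uᵀ * u = 1
  eig : x * xᵀ * u = u * diagonal fun k => d k ^ 2
  le_of_orth : ∀ k (y : Fin T → ℝ), (∀ j, j < k → (uᵀ *ᵥ y) j = 0) →
    y ⬝ᵥ ((x * xᵀ) *ᵥ y) ≤ d k ^ 2 * (y ⬝ᵥ y)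
  antitone : Antitone d
  nonneg : ∀ k, 0 ≤ d k

/-- Bessel's inequality for a matrix with orthonormal columns. -/
lemma transpose_mulVec_dotProduct_self_le {m n : Type*} [Fintype m] [Fintype n] [DecidableEq n]
    {U : Matrix m n ℝ} (hU : Uᵀ * U = 1) (y : m → ℝ) :
    (Uᵀ *ᵥ y) ⬝ᵥ (Uᵀ *ᵥ y) ≤ y ⬝ᵥ y := by
  have h0 : 0 ≤ (y - U *ᵥ (Uᵀ *ᵥ y)) ⬝ᵥ (y - U *ᵥ (Uᵀ *ᵥ y)) :=
    Finset.sum_nonneg fun i _ => mul_self_nonneg _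
  have h1 : y ⬝ᵥ (U *ᵥ (Uᵀ *ᵥ y)) = (Uᵀ *ᵥ y) ⬝ᵥ (Uᵀ *ᵥ y) := by
    rw [dotProduct_mulVec, ← mulVec_transpose]
  have h2 : (U *ᵥ (Uᵀ *ᵥ y)) ⬝ᵥ (U *ᵥ (Uᵀ *ᵥ y)) = (Uᵀ *ᵥ y) ⬝ᵥ (Uᵀ *ᵥ y) := by
    rw [dotProduct_mulVec, ← mulVec_transpose, mulVec_mulVec, hU, one_mulVec]
  rw [sub_dotProduct, dotProduct_sub, dotProduct_sub, h2,
    dotProduct_comm (U *ᵥ _) y, h1] at h0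
  linarith

lemma IsSVD.mul_transpose {T N : ℕ} {Z : Matrix (Fin T) (Fin N) ℝ}
    {U : Matrix (Fin T) (Fin (min T N)) ℝ} {s : Fin (min T N) → ℝ}
    {V : Matrix (Fin N) (Fin (min T N)) ℝ} (h : IsSVD Z U s V) :
    Z * Zᵀ = U * (diagonal fun k => s k ^ 2) * Uᵀ := by
  have h1 : diagonal s * diagonal s = diagonal fun k => s k ^ 2 := by
    rw [diagonal_mul_diagonal]
    simp [sq]
  rw [h.eq, transpose_mul, transpose_mul, transpose_transpose, diagonal_transpose, ← h1]
  calc U * diagonal s * Vᵀ * (V * (diagonal s * Uᵀ))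
      = U * diagonal s * (Vᵀ * V) * (diagonal s * Uᵀ) := by simp only [Matrix.mul_assoc]
    _ = _ := by rw [h.orth_V, Matrix.mul_one]; simp only [Matrix.mul_assoc]

/-- The variational bound holds because the coordinates of `y` along the columns before `k` vanish,
all later singular values are at most `s k`, and Bessel's inequality bounds the sum of the remaining
squared coordinates. -/
lemma IsSVD.isPC {T N r : ℕ} {Z : Matrix (Fin T) (Fin N) ℝ}
    {U : Matrix (Fin T) (Fin (min T N)) ℝ} {s : Fin (min T N) → ℝ}
    {V : Matrix (Fin N) (Fin (min T N)) ℝ} (h : IsSVD Z U s V) (hr : r ≤ min T N) :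
    IsPC Z (U.submatrix id (Fin.castLE hr)) (s ∘ Fin.castLE hr) where
  orth := by
    have h1 : (U.submatrix id (Fin.castLE hr))ᵀ * U.submatrix id (Fin.castLE hr)
        = (Uᵀ * U).submatrix (Fin.castLE hr) (Fin.castLE hr) := by
      rw [transpose_submatrix, submatrix_mul _ _ _ id _ Function.bijective_id]
    rw [h1, h.orth_U, submatrix_one _ (Fin.castLE_injective hr)]
  eig := by
    rw [h.mul_transpose, Matrix.mul_assoc]
    have h1 : Uᵀ * U.submatrix id (Fin.castLE hr)
        = (1 : Matrix (Fin (min T N)) (Fin (min T N)) ℝ).submatrix id (Fin.castLE hr) := by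
      rw [← h.orth_U, submatrix_mul _ _ _ id _ Function.bijective_id, submatrix_id_id]
    rw [h1]
    ext t k
    rw [Matrix.mul_apply, mul_diagonal]
    simp only [mul_diagonal, submatrix_apply, id, one_apply, mul_ite, mul_one, mul_zero,
      Finset.sum_ite_eq', Finset.mem_univ, if_true, Function.comp]
  le_of_orth := by
    intro k y hy
    have h1 : y ⬝ᵥ ((Z * Zᵀ) *ᵥ y) = ∑ j, s j ^ 2 * (Uᵀ *ᵥ y) j ^ 2 := by
      rw [h.mul_transpose, ← mulVec_mulVec, ← mulVec_mulVec, dotProduct_mulVec, ← mulVec_transpose,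
        dotProduct]
      exact Finset.sum_congr rfl fun j _ => by rw [mulVec_diagonal]; ring
    rw [h1]
    calc ∑ j, s j ^ 2 * (Uᵀ *ᵥ y) j ^ 2
        ≤ ∑ j, s (Fin.castLE hr k) ^ 2 * (Uᵀ *ᵥ y) j ^ 2 := by
          refine Finset.sum_le_sum fun j _ => ?_
          rcases lt_or_ge j (Fin.castLE hr k) with hj | hj
          · have hjr : j.val < r := lt_trans hj k.2
            have h2 : (Uᵀ *ᵥ y) j = 0 := hy ⟨j.val, hjr⟩ hj
            rw [h2]
            simp
          · exact mul_le_mul_of_nonneg_right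
              (pow_le_pow_left₀ (h.nonneg _) (h.antitone hj) 2) (sq_nonneg _)
      _ = s (Fin.castLE hr k) ^ 2 * ((Uᵀ *ᵥ y) ⬝ᵥ (Uᵀ *ᵥ y)) := by
          rw [← Finset.mul_sum, dotProduct]
          simp only [sq]
      _ ≤ _ := mul_le_mul_of_nonneg_left (transpose_mulVec_dotProduct_self_le h.orth_U y)
          (sq_nonneg _)
  antitone := fun i j hij => h.antitone (by simpa using hij)
  nonneg := fun k => h.nonneg _

section APC

variable {T N r : ℕ} {Y : Matrix (Fin T) (Fin N) ℝ} {Fh : Matrix (Fin T) (Fin r) ℝ}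
  {Lh : Matrix (Fin N) (Fin r) ℝ} {d : Fin r → ℝ}

lemma IsAPC.isPC (h : IsAPC Y Fh Lh d) (hT : 0 < T) :
    IsPC ((1 / √((N : ℝ) * T)) • Y) ((1 / √(T : ℝ)) • Fh) d := by
  obtain ⟨U, s, V, hs, hr, rfl, rfl, rfl⟩ := h
  have h1 : √(T : ℝ) ≠ 0 := by positivity
  rw [smul_smul, one_div_mul_cancel h1, one_smul]
  simpa using hs.isPC hr

/-- With `Z = U D V'` one has `Z' U_r = V D (U' U_r) = V_r D_r`: the loadings are the projection of
the data on the estimated factors. Statements about loadings are thereby reduced to statements about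
`u`. -/
lemma IsAPC.loadings (h : IsAPC Y Fh Lh d) (hT : 0 < T) (hN : 0 < N) :
    (1 / √(N : ℝ)) • Lh = ((1 / √((N : ℝ) * T)) • Y)ᵀ * ((1 / √(T : ℝ)) • Fh) := by
  obtain ⟨U, s, V, hs, hr, rfl, rfl, rfl⟩ := h
  have h1 : √(T : ℝ) ≠ 0 := by positivity
  have h2 : √(N : ℝ) ≠ 0 := by positivity
  rw [smul_smul, smul_smul, one_div_mul_cancel h1, one_div_mul_cancel h2, one_smul,
    one_smul, hs.eq, transpose_mul, transpose_mul, transpose_transpose, diagonal_transpose,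
    Matrix.mul_assoc, Matrix.mul_assoc]
  have h3 : Uᵀ * U.submatrix id (Fin.castLE hr)
      = (1 : Matrix (Fin (min T N)) (Fin (min T N)) ℝ).submatrix id (Fin.castLE hr) := by
    rw [← hs.orth_U, submatrix_mul _ _ _ id _ Function.bijective_id, submatrix_id_id]
  rw [h3]
  ext i k
  rw [mul_diagonal, Matrix.mul_apply]
  simp only [diagonal_mul, submatrix_apply, id, one_apply, mul_ite, mul_one, mul_zero,
    Finset.sum_ite_eq', Finset.mem_univ, if_true, Function.comp]

end APC

namespace IsPC

variable {T N r : ℕ} {x : Matrix (Fin T) (Fin N) ℝ} {u : Matrix (Fin T) (Fin r) ℝ}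
  {d : Fin r → ℝ}

lemma frob_eq (h : IsPC x u d) : frob u = √r := by
  have := frob_sq_eq_trace u
  rw [h.orth, trace_one, Fintype.card_fin] at this
  rw [← this, Real.sqrt_sq (frob_nonneg u)]

/-- The leading singular values of an approximate factor structure are bounded below. -/
lemma exists_lower_bound {A B : Matrix (Fin r) (Fin r) ℝ} (hA : A.PosDef) (hB : B.PosDef) :
    ∃ c > 0, ∃ κ > 0, ∀ (T N : ℕ) (x : Matrix (Fin T) (Fin N) ℝ) (u : Matrix (Fin T) (Fin r) ℝ)
      (d : Fin r → ℝ) (f : Matrix (Fin T) (Fin r) ℝ) (b : Matrix (Fin r) (Fin r) ℝ),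
      IsPC x u d → frob (fᵀ * f - A) < κ → frob (b - B) < κ →
      frob (x * xᵀ - f * b * fᵀ) < κ → ∀ k, c ≤ d k ^ 2 := by
  obtain ⟨α, hα, hα'⟩ := hA.exists_lower_bound
  obtain ⟨β, hβ, hβ'⟩ := hB.exists_lower_bound
  -- Perturbation halves `α` and `β`, so the quadratic form of `f b fᵀ` at `y` is at least
  -- `(α/2)(β/2)` times `y ⬝ᵥ y`. The error of `x xᵀ` takes away at most half of that.
  refine ⟨α * β / 8, by positivity, min (min (α / 2) (β / 2)) (α * β / 8), by positivity, ?_⟩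
  intro T N x u d f b hpc ha hb hE k
  simp only [lt_min_iff] at ha hb hE
  -- Dimension count: fewer than `r` linear conditions on `z` in an `r`-dimensional space. The
  -- vector `f z` is then orthogonal to the columns of `u` before `k`, where the variational bound
  -- applies.
  obtain ⟨z, hz0, hz⟩ : ∃ z : Fin r → ℝ, z ≠ 0 ∧ ∀ j, j < k → (uᵀ *ᵥ (f *ᵥ z)) j = 0 := by
    let φ : (Fin r → ℝ) →ₗ[ℝ] ({j : Fin r // j < k} → ℝ) :=
      (LinearMap.funLeft ℝ ℝ Subtype.val).comp (Matrix.toLin' (uᵀ * f))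
    have hφ : LinearMap.ker φ ≠ ⊥ := by
      refine LinearMap.ker_ne_bot_of_finrank_lt ?_
      rw [Module.finrank_fintype_fun_eq_card, Module.finrank_fintype_fun_eq_card]
      exact Fintype.card_subtype_lt (x := k) (lt_irrefl k)
    obtain ⟨z, hz, hz0⟩ := (Submodule.ne_bot_iff _).1 hφ
    refine ⟨z, hz0, fun j hj => ?_⟩
    have h1 := congrFun (LinearMap.mem_ker.1 hz) ⟨j, hj⟩
    rw [mulVec_mulVec]
    simpa [φ] using h1
  set y := f *ᵥ z with hy
  set w := (fᵀ * f) *ᵥ z with hw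
  have hfy : fᵀ *ᵥ y = w := by rw [hy, mulVec_mulVec]
  have hyy : y ⬝ᵥ y = z ⬝ᵥ w := by
    rw [← hfy, mulVec_transpose, dotProduct_comm z, ← dotProduct_mulVec]
  have hzz : 0 < z ⬝ᵥ z := by
    have : 0 ≤ z ⬝ᵥ z := Finset.sum_nonneg fun i _ => mul_self_nonneg _
    exact lt_of_le_of_ne this fun h => hz0 (dotProduct_self_eq_zero.1 h.symm)
  have hww : 0 ≤ w ⬝ᵥ w := Finset.sum_nonneg fun i _ => mul_self_nonneg _
  have h1 : α / 2 * (z ⬝ᵥ z) ≤ z ⬝ᵥ w := by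
    have e1 : z ⬝ᵥ w = z ⬝ᵥ (A *ᵥ z) + z ⬝ᵥ ((fᵀ * f - A) *ᵥ z) := by
      rw [sub_mulVec, dotProduct_sub, hw]
      ring
    have e2 := (abs_le.1 (abs_dotProduct_mulVec_le_frob (fᵀ * f - A) z)).1
    have e3 := hα' z
    nlinarith [ha.1.1]
  have h2 : β / 2 * (w ⬝ᵥ w) ≤ w ⬝ᵥ (b *ᵥ w) := by
    have e1 : w ⬝ᵥ (b *ᵥ w) = w ⬝ᵥ (B *ᵥ w) + w ⬝ᵥ ((b - B) *ᵥ w) := by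
      rw [sub_mulVec, dotProduct_sub]
      ring
    have e2 := (abs_le.1 (abs_dotProduct_mulVec_le_frob (b - B) w)).1
    have e3 := hβ' w
    nlinarith [hb.1.2]
  have hzw : 0 < z ⬝ᵥ w := lt_of_lt_of_le (by positivity) h1
  -- Cauchy–Schwarz for `z` and `w`, with `h1` to bound `z ⬝ᵥ z` by `z ⬝ᵥ w`; the positive factor `z
  -- ⬝ᵥ w` is then cancelled.
  have h3 : α / 2 * (z ⬝ᵥ w) ≤ w ⬝ᵥ w := by
    have e1 : (z ⬝ᵥ w) ^ 2 ≤ (z ⬝ᵥ z) * (w ⬝ᵥ w) := by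
      have := Finset.sum_mul_sq_le_sq_mul_sq Finset.univ z w
      simpa [dotProduct, sq] using this
    have e2 : α / 2 * (z ⬝ᵥ w) ^ 2 ≤ (z ⬝ᵥ w) * (w ⬝ᵥ w) := by
      calc α / 2 * (z ⬝ᵥ w) ^ 2 ≤ α / 2 * ((z ⬝ᵥ z) * (w ⬝ᵥ w)) := by gcongr
        _ = α / 2 * (z ⬝ᵥ z) * (w ⬝ᵥ w) := by ring
        _ ≤ _ := mul_le_mul_of_nonneg_right h1 hww
    nlinarith
  have h4 : y ⬝ᵥ ((x * xᵀ) *ᵥ y) = w ⬝ᵥ (b *ᵥ w) + y ⬝ᵥ ((x * xᵀ - f * b * fᵀ) *ᵥ y) := by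
    have e1 : y ⬝ᵥ ((f * b * fᵀ) *ᵥ y) = w ⬝ᵥ (b *ᵥ w) := by
      rw [← mulVec_mulVec, ← mulVec_mulVec, hfy, dotProduct_mulVec, ← mulVec_transpose, hfy]
    rw [sub_mulVec, dotProduct_sub, e1]
    ring
  have h5 := (abs_le.1 (abs_dotProduct_mulVec_le_frob (x * xᵀ - f * b * fᵀ) y)).1
  have h6 := hpc.le_of_orth k y hz
  rw [h4] at h6
  rw [hyy] at h5 h6
  have h7 : α * β / 4 * (z ⬝ᵥ w) ≤ w ⬝ᵥ (b *ᵥ w) := by nlinarith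
  have h8 : (α * β / 8) * (z ⬝ᵥ w) ≤ d k ^ 2 * (z ⬝ᵥ w) := by nlinarith [hE.2]
  exact le_of_mul_le_mul_right h8 hzw

end IsPC

/-! ### Approximation of random matrices in probability -/

section Near

variable {Ω : Type*} [MeasurableSpace Ω] {μ : Measure Ω} {ρ : ℕ → ℝ} {m k l : ℕ → ℕ}

/-- The Frobenius norms of the random matrices are bounded in probability. -/
def BddInProb (μ : Measure Ω) (A : ∀ n, Ω → Matrix (Fin (m n)) (Fin (k n)) ℝ) : Prop :=
  IsBigOp μ (fun n ω => frob (A n ω)) fun _ => 1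

/-- The Frobenius distance of the random matrices is `O_p(ρ n)`. -/
def Near (μ : Measure Ω) (ρ : ℕ → ℝ) (A B : ∀ n, Ω → Matrix (Fin (m n)) (Fin (k n)) ℝ) : Prop :=
  IsBigOp μ (fun n ω => frob (A n ω - B n ω)) ρ

lemma IsBigOp.frob_le {Z : ℕ → Ω → ℝ} {a : ℕ → ℝ} (hZ : IsBigOp μ Z a)
    {A : ∀ n, Ω → Matrix (Fin (m n)) (Fin (k n)) ℝ}
    (h : ∀ᶠ i in probFilter μ, frob (A i.1 i.2) ≤ Z i.1 i.2) :
    IsBigOp μ (fun n ω => frob (A n ω)) a := by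
  refine hZ.mono ?_
  filter_upwards [h] with i hi
  rw [abs_of_nonneg (frob_nonneg _)]
  exact hi.trans (le_abs_self _)

lemma IsBigOp.frob_mul {a b : ℕ → ℝ} (ha : ∀ n, 0 ≤ a n) (hb : ∀ n, 0 ≤ b n)
    {A : ∀ n, Ω → Matrix (Fin (m n)) (Fin (k n)) ℝ} {B : ∀ n, Ω → Matrix (Fin (k n)) (Fin (l n)) ℝ}
    (hA : IsBigOp μ (fun n ω => frob (A n ω)) a) (hB : IsBigOp μ (fun n ω => frob (B n ω)) b) :
    IsBigOp μ (fun n ω => frob (A n ω * B n ω)) fun n => a n * b n :=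
  (hA.mul ha hb hB).frob_le (Eventually.of_forall fun _ => frob_mul_le _ _)

lemma IsBigOp.frob_mul_right (hρ : ∀ n, 0 ≤ ρ n)
    {A : ∀ n, Ω → Matrix (Fin (m n)) (Fin (k n)) ℝ} {B : ∀ n, Ω → Matrix (Fin (k n)) (Fin (l n)) ℝ}
    (hA : IsBigOp μ (fun n ω => frob (A n ω)) ρ) (hB : BddInProb μ B) :
    IsBigOp μ (fun n ω => frob (A n ω * B n ω)) ρ := by
  simpa using hA.frob_mul hρ (fun _ => zero_le_one) hB

lemma IsBigOp.frob_mul_left (hρ : ∀ n, 0 ≤ ρ n)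
    {A : ∀ n, Ω → Matrix (Fin (m n)) (Fin (k n)) ℝ} {B : ∀ n, Ω → Matrix (Fin (k n)) (Fin (l n)) ℝ}
    (hB : IsBigOp μ (fun n ω => frob (B n ω)) ρ) (hA : BddInProb μ A) :
    IsBigOp μ (fun n ω => frob (A n ω * B n ω)) ρ := by
  simpa using IsBigOp.frob_mul (fun _ => zero_le_one) hρ hA hB

lemma IsBigOp.frob_add {a : ℕ → ℝ} {A B : ∀ n, Ω → Matrix (Fin (m n)) (Fin (k n)) ℝ}
    (hA : IsBigOp μ (fun n ω => frob (A n ω)) a) (hB : IsBigOp μ (fun n ω => frob (B n ω)) a) :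
    IsBigOp μ (fun n ω => frob (A n ω + B n ω)) a :=
  (hA.add hB).frob_le (Eventually.of_forall fun _ => frob_add_le _ _)

lemma IsBigOp.frob_transpose {a : ℕ → ℝ} {A : ∀ n, Ω → Matrix (Fin (m n)) (Fin (k n)) ℝ}
    (hA : IsBigOp μ (fun n ω => frob (A n ω)) a) : IsBigOp μ (fun n ω => frob (A n ω)ᵀ) a := by
  simpa using hA

/-- A vanishing rate may be replaced by a bounded one. -/
lemma IsBigOp.bdd (hρ : ∀ n, 0 ≤ ρ n) (hρ0 : Tendsto ρ atTop (𝓝 0)) {Y : ℕ → Ω → ℝ}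
    (h : IsBigOp μ Y ρ) : IsBigOp μ Y fun _ => 1 := by
  refine h.rate_mono (Eventually.of_forall hρ) ?_
  filter_upwards [hρ0.eventually (gt_mem_nhds zero_lt_one)] with n hn using hn.le

namespace BddInProb

lemma mul {A : ∀ n, Ω → Matrix (Fin (m n)) (Fin (k n)) ℝ}
    {B : ∀ n, Ω → Matrix (Fin (k n)) (Fin (l n)) ℝ} (hA : BddInProb μ A) (hB : BddInProb μ B) :
    BddInProb μ fun n ω => A n ω * B n ω :=
  IsBigOp.frob_mul_right (fun _ => zero_le_one) hA hB

lemma transpose {A : ∀ n, Ω → Matrix (Fin (m n)) (Fin (k n)) ℝ} (hA : BddInProb μ A) :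
    BddInProb μ fun n ω => (A n ω)ᵀ := IsBigOp.frob_transpose hA

lemma of_tendsto {r s : ℕ} {A : ℕ → Ω → Matrix (Fin r) (Fin s) ℝ} {A₀ : Matrix (Fin r) (Fin s) ℝ}
    (h : Tendsto (fun i : ℕ × Ω => A i.1 i.2) (probFilter μ) (𝓝 A₀)) : BddInProb μ A :=
  IsBigOp.of_tendsto (tendsto_frob h)

end BddInProb

namespace Near

variable {A A' A'' : ∀ n, Ω → Matrix (Fin (m n)) (Fin (k n)) ℝ}
  {B B' : ∀ n, Ω → Matrix (Fin (k n)) (Fin (l n)) ℝ}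

lemma trans (h : Near μ ρ A A') (h' : Near μ ρ A' A'') : Near μ ρ A A'' :=
  (h.add h').frob_le (Eventually.of_forall fun i => by
    simpa using frob_add_le (A i.1 i.2 - A' i.1 i.2) (A' i.1 i.2 - A'' i.1 i.2))

lemma symm (h : Near μ ρ A A') : Near μ ρ A' A :=
  IsBigOp.frob_le h (Eventually.of_forall fun i => by
    rw [← frob_neg, neg_sub])

lemma transpose (h : Near μ ρ A A') : Near μ ρ (fun n ω => (A n ω)ᵀ) fun n ω => (A' n ω)ᵀ := by
  refine IsBigOp.frob_le h (Eventually.of_forall fun i => ?_)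
  rw [← transpose_sub, frob_transpose]

lemma bdd (hρ : ∀ n, 0 ≤ ρ n) (hρ0 : Tendsto ρ atTop (𝓝 0)) (h : Near μ ρ A A')
    (hA : BddInProb μ A') : BddInProb μ A :=
  ((IsBigOp.bdd hρ hρ0 h).add hA).frob_le (Eventually.of_forall fun i => by
    simpa using frob_add_le (A i.1 i.2 - A' i.1 i.2) (A' i.1 i.2))

lemma mul (hρ : ∀ n, 0 ≤ ρ n) (hρ0 : Tendsto ρ atTop (𝓝 0)) (hA : Near μ ρ A A')
    (hB : Near μ ρ B B') (hA' : BddInProb μ A') (hB' : BddInProb μ B') :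
    Near μ ρ (fun n ω => A n ω * B n ω) fun n ω => A' n ω * B' n ω := by
  have h1 := (IsBigOp.frob_mul_right hρ hA (hB.bdd hρ hρ0 hB')).frob_add
    (IsBigOp.frob_mul_left hρ hB hA')
  refine h1.frob_le (Eventually.of_forall fun i => le_of_eq ?_)
  congr 1
  rw [Matrix.sub_mul, Matrix.mul_sub]
  abel

lemma mul_left (hρ : ∀ n, 0 ≤ ρ n) (hB : Near μ ρ B B') (hA : BddInProb μ A) :
    Near μ ρ (fun n ω => A n ω * B n ω) fun n ω => A n ω * B' n ω := by
  refine (IsBigOp.frob_mul_left hρ hB hA).frob_le (Eventually.of_forall fun i => le_of_eq ?_)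
  rw [Matrix.mul_sub]

lemma mul_right (hρ : ∀ n, 0 ≤ ρ n) (hA : Near μ ρ A A') (hB : BddInProb μ B) :
    Near μ ρ (fun n ω => A n ω * B n ω) fun n ω => A' n ω * B n ω := by
  refine (IsBigOp.frob_mul_right hρ hA hB).frob_le (Eventually.of_forall fun i => le_of_eq ?_)
  rw [Matrix.sub_mul]

lemma congr' (h : Near μ ρ A A') {C C' : ∀ n, Ω → Matrix (Fin (m n)) (Fin (k n)) ℝ}
    (hA : ∀ᶠ i in probFilter μ, A i.1 i.2 = C i.1 i.2)
    (hA' : ∀ᶠ i in probFilter μ, A' i.1 i.2 = C' i.1 i.2) : Near μ ρ C C' := by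
  refine IsBigOp.frob_le h ?_
  filter_upwards [hA, hA'] with i h1 h2
  rw [h1, h2]

end Near

lemma Near.congr_left {A A' C : ∀ n, Ω → Matrix (Fin (m n)) (Fin (k n)) ℝ} (h : Near μ ρ A A')
    (hA : ∀ᶠ n in atTop, ∀ ω, A n ω = C n ω) : Near μ ρ C A' :=
  h.congr' (eventually_probFilter_of_forall (P := fun n ω => A n ω = C n ω) hA)
    (Eventually.of_forall fun _ => rfl)

/-! ### Approximate inverses. -/

section Inverse

variable {r : ℕ} {P Q : ℕ → Ω → Matrix (Fin r) (Fin r) ℝ}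

/-- A matrix with an approximate inverse is invertible, with inverse bounded in probability. -/
lemma Near.inverse (hρ0 : Tendsto ρ atTop (𝓝 0))
    (h : Near μ ρ (fun n ω => P n ω * Q n ω) fun _ _ => 1)
    (hQ : BddInProb μ Q) :
    (∀ᶠ i in probFilter μ, IsUnit (P i.1 i.2).det) ∧ BddInProb μ fun n ω => (P n ω)⁻¹ := by
  have h1 : Tendsto (fun i : ℕ × Ω => P i.1 i.2 * Q i.1 i.2) (probFilter μ) (𝓝 1) :=
    tendsto_of_frob_sub
      (IsBigOp.tendsto_zero (Y := fun n ω => frob (P n ω * Q n ω - 1)) h hρ0)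
  have hdet : Tendsto (fun i : ℕ × Ω => (P i.1 i.2 * Q i.1 i.2).det) (probFilter μ) (𝓝 1) := by
    have h2 := ((continuous_id.matrix_det (n := Fin r) (R := ℝ)).tendsto 1).comp h1
    rw [id, det_one] at h2
    exact h2
  have hadj : Tendsto (fun i : ℕ × Ω => (P i.1 i.2 * Q i.1 i.2).adjugate) (probFilter μ) (𝓝 1) := by
    have h2 := ((continuous_id.matrix_adjugate (n := Fin r) (R := ℝ)).tendsto 1).comp h1
    rw [id, adjugate_one] at h2
    exact h2
  -- The inverse is the adjugate divided by the determinant, hence continuous at the identity. No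
  -- limit of `P` or of `Q` alone is needed, since `P⁻¹ = Q (P Q)⁻¹`.
  have hinv : Tendsto (fun i : ℕ × Ω => (P i.1 i.2 * Q i.1 i.2)⁻¹) (probFilter μ) (𝓝 1) := by
    have h2 := (hdet.inv₀ one_ne_zero).smul hadj
    rw [inv_one, one_smul] at h2
    refine h2.congr fun i => ?_
    rw [Matrix.inv_def, Ring.inverse_eq_inv']
  have hne : ∀ᶠ i in probFilter μ, (P i.1 i.2 * Q i.1 i.2).det ≠ 0 :=
    hdet.eventually_ne one_ne_zero
  have hunit : ∀ᶠ i in probFilter μ, IsUnit (P i.1 i.2).det := by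
    filter_upwards [hne] with i hi
    rw [det_mul] at hi
    exact isUnit_iff_ne_zero.2 (left_ne_zero_of_mul hi)
  have hbdd : BddInProb μ fun n ω => Q n ω * (P n ω * Q n ω)⁻¹ :=
    hQ.mul (BddInProb.of_tendsto (A := fun n ω => (P n ω * Q n ω)⁻¹) hinv)
  refine ⟨hunit, IsBigOp.frob_le hbdd ?_⟩
  filter_upwards [hne] with i hi
  have h3 : (P i.1 i.2)⁻¹ = Q i.1 i.2 * (P i.1 i.2 * Q i.1 i.2)⁻¹ := by
    refine Matrix.inv_eq_right_inv ?_
    rw [← Matrix.mul_assoc, Matrix.mul_nonsing_inv _ (isUnit_iff_ne_zero.2 hi)]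
  rw [h3]

/-- Conjugation: `Q P = P⁻¹ (P Q) P`, and `P` and `P⁻¹` are bounded in probability, so the rate is
kept. -/
lemma Near.mul_comm_one (hρ : ∀ n, 0 ≤ ρ n) (hρ0 : Tendsto ρ atTop (𝓝 0))
    (h : Near μ ρ (fun n ω => P n ω * Q n ω) fun _ _ => 1)
    (hP : BddInProb μ P) (hQ : BddInProb μ Q) :
    Near μ ρ (fun n ω => Q n ω * P n ω) fun _ _ => 1 := by
  obtain ⟨hu, hb⟩ := h.inverse hρ0 hQ
  refine ((h.mul_right hρ hP).mul_left hρ hb).congr' ?_ ?_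
  · filter_upwards [hu] with i hi
    rw [Matrix.mul_assoc, ← Matrix.mul_assoc, nonsing_inv_mul _ hi, Matrix.one_mul]
  · filter_upwards [hu] with i hi
    rw [Matrix.one_mul, nonsing_inv_mul _ hi]

end Inverse

end Near

/-! ### Principal components of an approximate factor structure -/

/-- The matrices `x xᵀ` are approximated by `f b fᵀ` at the rate `ρ`, and `u`, `d` are principal
components of `x`. -/
structure FactorApprox {Ω : Type*} [MeasurableSpace Ω] (μ : Measure Ω) (ρ : ℕ → ℝ) {r : ℕ}
    {T N : ℕ → ℕ} (A B : Matrix (Fin r) (Fin r) ℝ) (f : ∀ n, Ω → Matrix (Fin (T n)) (Fin r) ℝ)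
    (b : ℕ → Matrix (Fin r) (Fin r) ℝ) (x : ∀ n, Ω → Matrix (Fin (T n)) (Fin (N n)) ℝ)
    (u : ∀ n, Ω → Matrix (Fin (T n)) (Fin r) ℝ) (d : ℕ → Ω → Fin r → ℝ) : Prop where
  rate_nonneg : ∀ n, 0 ≤ ρ n
  tendsto_rate : Tendsto ρ atTop (𝓝 0)
  posDef_A : A.PosDef
  posDef_B : B.PosDef
  tendsto_f : Tendsto (fun i : ℕ × Ω => (f i.1 i.2)ᵀ * f i.1 i.2) (probFilter μ) (𝓝 A)
  tendsto_b : Tendsto b atTop (𝓝 B)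
  isPC : ∀ᶠ n in atTop, ∀ ω, IsPC (x n ω) (u n ω) (d n ω)
  approx : Near μ ρ (fun n ω => x n ω * (x n ω)ᵀ) fun n ω => f n ω * b n * (f n ω)ᵀ

namespace FactorApprox

variable {Ω : Type*} [MeasurableSpace Ω] {μ : Measure Ω} {ρ : ℕ → ℝ} {r : ℕ} {T N : ℕ → ℕ}
  {A B : Matrix (Fin r) (Fin r) ℝ} {f : ∀ n, Ω → Matrix (Fin (T n)) (Fin r) ℝ}
  {b : ℕ → Matrix (Fin r) (Fin r) ℝ} {x : ∀ n, Ω → Matrix (Fin (T n)) (Fin (N n)) ℝ}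
  {u : ∀ n, Ω → Matrix (Fin (T n)) (Fin r) ℝ} {d : ℕ → Ω → Fin r → ℝ}

/-- The factor coefficients `fᵀ u`. -/
def G (f u : ∀ n, Ω → Matrix (Fin (T n)) (Fin r) ℝ) (n : ℕ) (ω : Ω) : Matrix (Fin r) (Fin r) ℝ :=
  (f n ω)ᵀ * u n ω

/-- The rotation matrix `b fᵀ u D⁻²`. -/
noncomputable def H (f : ∀ n, Ω → Matrix (Fin (T n)) (Fin r) ℝ) (b : ℕ → Matrix (Fin r) (Fin r) ℝ)
    (u : ∀ n, Ω → Matrix (Fin (T n)) (Fin r) ℝ) (d : ℕ → Ω → Fin r → ℝ) (n : ℕ) (ω : Ω) :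
    Matrix (Fin r) (Fin r) ℝ :=
  b n * G f u n ω * diagonal fun k => (d n ω k ^ 2)⁻¹

variable (h : FactorApprox μ ρ A B f b x u d)
include h

lemma tendsto_b' : Tendsto (fun i : ℕ × Ω => b i.1) (probFilter μ) (𝓝 B) :=
  h.tendsto_b.comp tendsto_fst_probFilter

lemma tendsto_frob_f : Tendsto (fun i : ℕ × Ω => frob (f i.1 i.2)) (probFilter μ) (𝓝 √A.trace) := by
  have h1 : Continuous fun A : Matrix (Fin r) (Fin r) ℝ => √A.trace := by fun_prop
  refine ((h1.tendsto A).comp h.tendsto_f).congr fun i => ?_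
  rw [Function.comp, ← frob_sq_eq_trace, Real.sqrt_sq (frob_nonneg _)]

lemma bdd_f : BddInProb μ f := IsBigOp.of_tendsto h.tendsto_frob_f

lemma eventually_isPC : ∀ᶠ i in probFilter μ, IsPC (x i.1 i.2) (u i.1 i.2) (d i.1 i.2) :=
  eventually_probFilter_of_forall (P := fun n ω => IsPC (x n ω) (u n ω) (d n ω)) h.isPC

lemma bdd_u : BddInProb μ u := by
  refine (IsBigOp.const √(r : ℝ)).frob_le ?_
  filter_upwards [h.eventually_isPC] with i hi using hi.frob_eq.le

lemma bdd_b : BddInProb μ fun n _ => b n := BddInProb.of_tendsto h.tendsto_b'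

lemma bdd_G : BddInProb μ (G f u) := h.bdd_f.transpose.mul h.bdd_u

lemma exists_lower_bound : ∃ c > 0, ∀ᶠ i in probFilter μ, ∀ k, c ≤ d i.1 i.2 k ^ 2 := by
  obtain ⟨c, hc, κ, hκ, hcκ⟩ := IsPC.exists_lower_bound h.posDef_A h.posDef_B
  refine ⟨c, hc, ?_⟩
  filter_upwards [h.eventually_isPC, (tendsto_frob_sub h.tendsto_f).eventually (gt_mem_nhds hκ),
    (tendsto_frob_sub h.tendsto_b').eventually (gt_mem_nhds hκ),
    (IsBigOp.tendsto_zero h.approx h.tendsto_rate).eventually (gt_mem_nhds hκ)] with i h1 h2 h3 h4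
  exact hcκ _ _ _ _ _ _ _ h1 h2 h3 h4

lemma bdd_inv : BddInProb μ fun n ω => diagonal fun k => (d n ω k ^ 2)⁻¹ := by
  obtain ⟨c, hc, hd⟩ := h.exists_lower_bound
  refine (IsBigOp.const (frob (diagonal fun _ : Fin r => c⁻¹))).frob_le ?_
  filter_upwards [hd] with i hi
  refine frob_mono fun j k => ?_
  rcases eq_or_ne j k with rfl | hjk
  · rw [diagonal_apply_eq, diagonal_apply_eq, abs_of_nonneg (by positivity),
      abs_of_nonneg (by positivity)]
    exact inv_anti₀ hc (hi j)
  · simp [hjk]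

lemma bdd_H : BddInProb μ (H f b u d) := (h.bdd_b.mul h.bdd_G).mul h.bdd_inv

/-- The equation `x xᵀ u = u D²` divided by `D²` reads `u = x xᵀ u D⁻²`; replace `x xᵀ` by `f b fᵀ`.
The lower bound on the singular values makes the division legitimate and keeps `D⁻²` bounded. -/
lemma near_u : Near μ ρ u fun n ω => f n ω * H f b u d n ω := by
  obtain ⟨c, hc, hd⟩ := h.exists_lower_bound
  refine ((h.approx.mul_right h.rate_nonneg h.bdd_u).mul_right h.rate_nonneg h.bdd_inv).congr' ?_ ?_
  · filter_upwards [hd, h.eventually_isPC] with i hi hpc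
    rw [hpc.eig, Matrix.mul_assoc, diagonal_mul_diagonal]
    have : (fun k => d i.1 i.2 k ^ 2 * (d i.1 i.2 k ^ 2)⁻¹) = fun _ => (1 : ℝ) :=
      funext fun k => mul_inv_cancel₀ (hc.trans_le (hi k)).ne'
    rw [this, diagonal_one, Matrix.mul_one]
  · exact Eventually.of_forall fun i => by simp only [H, G, Matrix.mul_assoc]

/-- Multiply `u ≈ f H` on the left by `uᵀ` and use `uᵀ u = 1`. -/
lemma near_GH : Near μ ρ (fun n ω => (G f u n ω)ᵀ * H f b u d n ω) fun _ _ => 1 := by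
  refine ((h.near_u.mul_left h.rate_nonneg h.bdd_u.transpose).congr' (C := fun _ _ => 1)
    (C' := fun n ω => (G f u n ω)ᵀ * H f b u d n ω) ?_ ?_).symm
  · filter_upwards [h.eventually_isPC] with i hi using hi.orth
  · refine Eventually.of_forall fun i => ?_
    simp only [G, transpose_mul, transpose_transpose, Matrix.mul_assoc]

/-- The order of factors in which rotations cancel between estimated factors and estimated loadings.
-/
lemma near_HG : Near μ ρ (fun n ω => H f b u d n ω * (G f u n ω)ᵀ) fun _ _ => 1 :=
  h.near_GH.mul_comm_one h.rate_nonneg h.tendsto_rate h.bdd_G.transpose h.bdd_H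

/-- The equation `G D² ≈ fᵀf b G`. -/
lemma near_eig : Near μ ρ (fun n ω => G f u n ω * diagonal fun k => d n ω k ^ 2)
    fun n ω => (f n ω)ᵀ * f n ω * b n * G f u n ω := by
  refine ((h.approx.mul_right h.rate_nonneg h.bdd_u).mul_left h.rate_nonneg
    h.bdd_f.transpose).congr' ?_ ?_
  · filter_upwards [h.eventually_isPC] with i hpc
    rw [hpc.eig, G, Matrix.mul_assoc]
  · exact Eventually.of_forall fun i => by simp only [G, Matrix.mul_assoc]

/-- The equation `D² ≈ Gᵀ b G`. -/
lemma near_diag : Near μ ρ (fun n ω => diagonal fun k => d n ω k ^ 2)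
    fun n ω => (G f u n ω)ᵀ * b n * G f u n ω := by
  refine ((h.approx.mul_right h.rate_nonneg h.bdd_u).mul_left h.rate_nonneg
    h.bdd_u.transpose).congr' ?_ ?_
  · filter_upwards [h.eventually_isPC] with i hpc
    rw [hpc.eig, ← Matrix.mul_assoc, hpc.orth, Matrix.one_mul]
  · exact Eventually.of_forall fun i => by
      simp only [G, transpose_mul, transpose_transpose, Matrix.mul_assoc]

end FactorApprox

/-! ### Limits of principal components -/

lemma Matrix.PosDef.isSymm {r : ℕ} {A : Matrix (Fin r) (Fin r) ℝ} (h : A.PosDef) : Aᵀ = A := by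
  have := h.isHermitian
  rwa [Matrix.IsHermitian, conjTranspose_eq_transpose_of_trivial] at this

/-- The eigenvalue equations determine the limits up to the signs of the columns. -/
lemma IsCompleteDataLimit.eq_of_eigen {r : ℕ} {SF SΛ Q G : Matrix (Fin r) (Fin r) ℝ}
    {v w : Fin r → ℝ} (hQ : IsCompleteDataLimit SF SΛ v Q) (hSF : SF.PosDef)
    (hdist : (SF * SΛ).charpoly.roots.Nodup) (hw : ∀ k, 0 < w k) (hanti : Antitone w)
    (h1 : G * diagonal w = SF * SΛ * G) (h2 : diagonal w = Gᵀ * SΛ * G) :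
    w = v ∧ ∃ s : Fin r → ℝ, (∀ k, s k = 1 ∨ s k = -1) ∧ diagonal s * Gᵀ = Q := by
  obtain ⟨S, Υ, hS, hSS, hΥ, hv, heig, rfl⟩ := hQ
  subst hSS
  have hSu : IsUnit S.det := (isUnit_iff_isUnit_det _).1 hS.isUnit
  have hΥ' : Υ * Υᵀ = 1 := mul_eq_one_comm.1 hΥ
  set K := S * SF * S with hK
  have hKsymm : Kᵀ = K := by
    rw [hK, transpose_mul, transpose_mul, hS.isSymm, hSF.isSymm, Matrix.mul_assoc]
  have hKΥ : Υᵀ * K = diagonal v * Υᵀ := by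
    have := congrArg transpose heig
    rwa [transpose_mul K, transpose_mul Υ, hKsymm, diagonal_transpose] at this
  have hKeq : K = Υ * diagonal v * Υᵀ := by
    rw [← heig, Matrix.mul_assoc, hΥ', Matrix.mul_one]
  have hvinj : Function.Injective v := by
    -- Cyclic invariance of the characteristic polynomial moves the distinct eigenvalues of `SF SΛ`
    -- to the symmetric matrix `K = S SF S`, whose eigenvalues are `v`.
    have e1 : (SF * (S * S)).charpoly = (diagonal v).charpoly := by
      rw [← Matrix.mul_assoc, charpoly_mul_comm, ← Matrix.mul_assoc, ← hK, hKeq, Matrix.mul_assoc,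
        charpoly_mul_comm, Matrix.mul_assoc, hΥ, Matrix.mul_one]
    have e2 : (diagonal v).charpoly.roots = Finset.univ.val.map v := by
      rw [charpoly_diagonal, ← Polynomial.roots_multiset_prod_X_sub_C (Finset.univ.val.map v),
        Multiset.map_map]
      rfl
    rw [e1, e2] at hdist
    have := (Multiset.nodup_map_iff_inj_on Finset.univ.nodup).1 hdist
    exact fun i j hij => this i (Finset.mem_univ i) j (Finset.mem_univ j) hij
  set D := diagonal fun k => √(w k) with hD
  set Di := diagonal fun k => (√(w k))⁻¹ with hDi
  have hDDi : D * Di = 1 := by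
    rw [hD, hDi, diagonal_mul_diagonal, ← diagonal_one]
    congr 1
    exact funext fun k => mul_inv_cancel₀ (Real.sqrt_pos.2 (hw k)).ne'
  have hDiD : Di * D = 1 := mul_eq_one_comm.1 hDDi
  have hDD : D * D = diagonal w := by
    rw [hD, diagonal_mul_diagonal]
    congr 1
    exact funext fun k => Real.mul_self_sqrt (hw k).le
  have hDw : diagonal w * Di = Di * diagonal w := by
    rw [hDi, diagonal_mul_diagonal, diagonal_mul_diagonal]
    congr 1
    exact funext fun k => mul_comm _ _
  -- The two equations say exactly that the columns of `R = S G diag(w)^(-1/2)` are orthonormal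
  -- eigenvectors of `K` with eigenvalues `w`.
  set R := S * G * Di with hR
  have hRR : Rᵀ * R = 1 := by
    have e1 : Diᵀ = Di := diagonal_transpose _
    calc Rᵀ * R = Di * (Gᵀ * (S * S) * G) * Di := by
          rw [hR, transpose_mul, transpose_mul, e1, hS.isSymm]
          simp only [Matrix.mul_assoc]
      _ = (Di * D) * (D * Di) := by rw [← h2, ← hDD]; simp only [Matrix.mul_assoc]
      _ = 1 := by rw [hDiD, hDDi, Matrix.one_mul]
  have hKR : K * R = R * diagonal w := by
    calc K * R = S * (SF * (S * S) * G) * Di := by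
          rw [hK, hR]
          simp only [Matrix.mul_assoc]
      _ = S * G * (diagonal w * Di) := by rw [← h1]; simp only [Matrix.mul_assoc]
      _ = R * diagonal w := by rw [hDw, hR]; simp only [Matrix.mul_assoc]
  -- The change between two orthonormal eigenbases of `K`: an orthogonal matrix that intertwines
  -- `diagonal v` and `diagonal w`, so a nonzero entry forces the corresponding eigenvalues to
  -- agree.
  set Z := Υᵀ * R with hZ
  have hZZ : Zᵀ * Z = 1 := by
    rw [hZ, transpose_mul, transpose_transpose, Matrix.mul_assoc, ← Matrix.mul_assoc Υ, hΥ',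
      Matrix.one_mul, hRR]
  have hZZ' : Z * Zᵀ = 1 := mul_eq_one_comm.1 hZZ
  have hZe : diagonal v * Z = Z * diagonal w := by
    rw [hZ, ← Matrix.mul_assoc, ← hKΥ, Matrix.mul_assoc Υᵀ K R, hKR, Matrix.mul_assoc Υᵀ R]
  have hZij : ∀ i j, Z i j ≠ 0 → v i = w j := by
    intro i j hij
    have := congrFun (congrFun hZe i) j
    rw [diagonal_mul, mul_diagonal, mul_comm] at this
    exact mul_left_cancel₀ hij this
  have hcol : ∀ j, ∃ i, Z i j ≠ 0 := by
    intro j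
    by_contra hc
    push Not at hc
    have := congrFun (congrFun hZZ j) j
    simp [Matrix.mul_apply, hc] at this
  have hrow : ∀ i, ∃ j, Z i j ≠ 0 := by
    intro i
    by_contra hc
    push Not at hc
    have := congrFun (congrFun hZZ' i) i
    simp [Matrix.mul_apply, hc] at this
  have hrange : Set.range w = Set.range v := by
    ext y
    constructor
    · rintro ⟨j, rfl⟩
      obtain ⟨i, hi⟩ := hcol j
      exact ⟨i, hZij i j hi⟩
    · rintro ⟨i, rfl⟩
      obtain ⟨j, hj⟩ := hrow i
      exact ⟨j, (hZij i j hj).symm⟩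
  -- A nonzero entry in each row of `Z` defines a map `σ` with `w ∘ σ = v`. It is injective because
  -- `v` is, hence a permutation, and `w` inherits injectivity.
  have hwinj : Function.Injective w := by
    choose σ hσ using hrow
    have hσ' : ∀ i, w (σ i) = v i := fun i => (hZij i _ (hσ i)).symm
    have hσinj : Function.Injective σ := fun i j hij => hvinj (by rw [← hσ', ← hσ', hij])
    have hσsurj := Finite.injective_iff_surjective.1 hσinj
    intro a b hab
    obtain ⟨i, rfl⟩ := hσsurj a
    obtain ⟨j, rfl⟩ := hσsurj b
    rw [hσ', hσ'] at hab
    rw [hvinj hab]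
  -- Two strictly decreasing families indexed by `Fin r` with the same range coincide; the signs are
  -- changed to make them increasing.
  have hwv : w = v := by
    have e1 : StrictMono fun k => -w k := (hanti.strictAnti_of_injective hwinj).neg
    have e2 : StrictMono fun k => -v k := (hv.strictAnti_of_injective hvinj).neg
    have e3 : Set.range (fun k => -w k) = Set.range fun k => -v k := by
      have := congrArg (fun s => Neg.neg '' s) hrange
      simpa only [← Set.range_comp, Function.comp_def] using this
    have e4 := (StrictMono.range_inj e1 e2).1 e3
    exact funext fun k => neg_injective (congrFun e4 k)
  -- Once `w = v` is injective, `Z` vanishes off the diagonal, and orthogonality makes its diagonal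
  -- entries `±1`: these are the signs.
  refine ⟨hwv, fun k => Z k k, ?_, ?_⟩
  · have hoff : ∀ i j, i ≠ j → Z i j = 0 := by
      intro i j hij
      by_contra hc
      exact hij (hvinj ((hZij i j hc).trans (congrFun hwv j)))
    intro k
    have := congrFun (congrFun hZZ k) k
    rw [Matrix.mul_apply, Finset.sum_eq_single k (fun i _ hik => by
      rw [transpose_apply, hoff i k hik, zero_mul]) (fun h => absurd (Finset.mem_univ k) h),
      transpose_apply, one_apply_eq] at this
    exact mul_self_eq_one_iff.1 this
  · have hoff : ∀ i j, i ≠ j → Z i j = 0 := by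
      intro i j hij
      by_contra hc
      exact hij (hvinj ((hZij i j hc).trans (congrFun hwv j)))
    have hZd : Z = diagonal fun k => Z k k := by
      ext i j
      rcases eq_or_ne i j with rfl | hij
      · simp
      · rw [hoff i j hij, diagonal_apply_ne _ hij]
    have hG : S * G = Υ * Z * D := by
      rw [hZ, ← Matrix.mul_assoc, hΥ', Matrix.one_mul, hR, Matrix.mul_assoc, hDiD, Matrix.mul_one]
    have hG' : Gᵀ * S = D * Zᵀ * Υᵀ := by
      have e1 : Dᵀ = D := diagonal_transpose _
      have := congrArg transpose hG
      rwa [transpose_mul, transpose_mul, transpose_mul, hS.isSymm, e1, ← Matrix.mul_assoc] at this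
    have hcomm : Z * D = D * Z := by
      rw [hZd, hD, diagonal_mul_diagonal, diagonal_mul_diagonal]
      congr 1
      exact funext fun k => mul_comm _ _
    have hGe : Gᵀ = D * Zᵀ * Υᵀ * S⁻¹ := by
      rw [← hG', Matrix.mul_assoc, mul_nonsing_inv _ hSu, Matrix.mul_one]
    rw [← hZd, hGe, ← hwv, ← hD]
    calc Z * (D * Zᵀ * Υᵀ * S⁻¹) = (Z * D) * Zᵀ * Υᵀ * S⁻¹ := by simp only [Matrix.mul_assoc]
      _ = D * (Z * Zᵀ) * Υᵀ * S⁻¹ := by rw [hcomm]; simp only [Matrix.mul_assoc]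
      _ = D * Υᵀ * S⁻¹ := by rw [hZZ', Matrix.mul_one]

/-- A bounded real function converges along an ultrafilter. -/
lemma Ultrafilter.exists_tendsto_of_bounded {ι : Type*} (g : Ultrafilter ι) {Y : ι → ℝ} {C : ℝ}
    (h : ∀ᶠ i in (g : Filter ι), |Y i| ≤ C) : ∃ c, Tendsto Y g (𝓝 c) := by
  obtain ⟨c, -, hc⟩ := (isCompact_Icc (a := -C) (b := C)).ultrafilter_le_nhds (g.map Y)
    (le_principal_iff.2 (by
      rw [Ultrafilter.coe_map, Filter.mem_map]
      filter_upwards [h] with i hi using abs_le.1 hi))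
  exact ⟨c, hc⟩

lemma tendsto_diagonal_iff {ι : Type*} {l : Filter ι} {r : ℕ} {w : ι → Fin r → ℝ}
    {v : Fin r → ℝ} : Tendsto (fun i => diagonal (w i)) l (𝓝 (diagonal v)) ↔ Tendsto w l (𝓝 v) := by
  constructor
  · intro h
    rw [tendsto_pi_nhds]
    intro k
    simpa using tendsto_matrix_iff.1 h k k
  · intro h
    exact ((continuous_id.matrix_diagonal (n := Fin r) (R := ℝ)).tendsto v).comp h

/-- Convergence up to the signs of the rows, along every ultrafilter, yields convergence for one
choice of the signs. -/
lemma exists_signs_of_ultrafilter {ι : Type*} {l : Filter ι} {r : ℕ}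
    {G : ι → Matrix (Fin r) (Fin r) ℝ} {Q : Matrix (Fin r) (Fin r) ℝ}
    (h : ∀ g : Ultrafilter ι, (g : Filter ι) ≤ l → ∃ s : Fin r → ℝ,
      (∀ k, s k = 1 ∨ s k = -1) ∧ Tendsto (fun i => diagonal s * (G i)ᵀ) g (𝓝 Q)) :
    ∃ s : ι → Fin r → ℝ, (∀ i k, s i k = 1 ∨ s i k = -1) ∧
      Tendsto (fun i => diagonal (s i) * (G i)ᵀ) l (𝓝 Q) := by
  let sg : (Fin r → ℤˣ) → Fin r → ℝ := fun s k => ((s k : ℤ) : ℝ)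
  have hsg : ∀ s k, sg s k = 1 ∨ sg s k = -1 := by
    intro s k
    rcases Int.units_eq_one_or (s k) with hk | hk <;> simp [sg, hk]
  have hsurj : ∀ s : Fin r → ℝ, (∀ k, s k = 1 ∨ s k = -1) → ∃ t, sg t = s := by
    intro s hs
    refine ⟨fun k => if s k = 1 then 1 else -1, funext fun k => ?_⟩
    rcases hs k with hk | hk
    · simp [sg, hk]
    · have : (-1 : ℝ) ≠ 1 := by norm_num
      simp [sg, hk, this]
  -- At each index take, among the finitely many sign vectors, one that brings the matrix closest to
  -- `Q`. This choice does not depend on the ultrafilter and does at least as well as the vector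
  -- that works along it.
  have hmin : ∀ i, ∃ t, ∀ t', frob (diagonal (sg t) * (G i)ᵀ - Q) ≤
      frob (diagonal (sg t') * (G i)ᵀ - Q) := fun i =>
    Finite.exists_min fun t => frob (diagonal (sg t) * (G i)ᵀ - Q)
  choose t ht using hmin
  refine ⟨fun i => sg (t i), fun i => hsg (t i), ?_⟩
  rw [tendsto_iff_ultrafilter]
  intro g hg
  obtain ⟨s, hs, hsQ⟩ := h g hg
  obtain ⟨t', rfl⟩ := hsurj s hs
  exact tendsto_of_frob_sub (squeeze_zero (fun _ => frob_nonneg _) (fun i => ht i t')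
    (tendsto_frob_sub hsQ))

namespace FactorApprox

variable {Ω : Type*} [MeasurableSpace Ω] {μ : Measure Ω} {ρ : ℕ → ℝ} {r : ℕ} {T N : ℕ → ℕ}
  {A B : Matrix (Fin r) (Fin r) ℝ} {f : ∀ n, Ω → Matrix (Fin (T n)) (Fin r) ℝ}
  {b : ℕ → Matrix (Fin r) (Fin r) ℝ} {x : ∀ n, Ω → Matrix (Fin (T n)) (Fin (N n)) ℝ}
  {u : ∀ n, Ω → Matrix (Fin (T n)) (Fin r) ℝ} {d : ℕ → Ω → Fin r → ℝ}

variable (h : FactorApprox μ ρ A B f b x u d)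
include h

/-- Boundedness of `G` suffices for a limit along an ultrafilter. The approximate eigenvalue
equations become exact there, and positivity and ordering of the limiting singular values pass
through the limit, so the algebraic uniqueness statement applies. -/
lemma ultrafilter_limit (hdist : (A * B).charpoly.roots.Nodup) {v : Fin r → ℝ}
    {Q : Matrix (Fin r) (Fin r) ℝ} (hQ : IsCompleteDataLimit A B v Q)
    (g : Ultrafilter (ℕ × Ω)) (hg : (g : Filter (ℕ × Ω)) ≤ probFilter μ) :
    Tendsto (fun (i : ℕ × Ω) k => d i.1 i.2 k ^ 2) g (𝓝 v) ∧
      ∃ s : Fin r → ℝ, (∀ k, s k = 1 ∨ s k = -1) ∧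
      Tendsto (fun i : ℕ × Ω => diagonal s * (G f u i.1 i.2)ᵀ) g (𝓝 Q) := by
  have hGb : ∀ᶠ i in (g : Filter (ℕ × Ω)), frob (G f u i.1 i.2) ≤ (√A.trace + 1) * √r := by
    refine hg ?_
    filter_upwards [h.tendsto_frob_f.eventually (gt_mem_nhds (lt_add_one _)),
      h.eventually_isPC] with i h1 h2
    calc frob (G f u i.1 i.2) ≤ frob (f i.1 i.2)ᵀ * frob (u i.1 i.2) := frob_mul_le _ _
      _ ≤ _ := by
        rw [frob_transpose, h2.frob_eq]
        exact mul_le_mul_of_nonneg_right h1.le (Real.sqrt_nonneg _)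
  have hlim : ∀ j k, ∃ c, Tendsto (fun i : ℕ × Ω => G f u i.1 i.2 j k) g (𝓝 c) := fun j k =>
    g.exists_tendsto_of_bounded (by
      filter_upwards [hGb] with i hi using (abs_apply_le_frob _ j k).trans hi)
  choose G₀ hG₀ using hlim
  have hG : Tendsto (fun i : ℕ × Ω => G f u i.1 i.2) g (𝓝 (Matrix.of G₀)) :=
    tendsto_matrix_iff.2 hG₀
  have hb := h.tendsto_b'.mono_left hg
  have ha := h.tendsto_f.mono_left hg
  have hGt : Tendsto (fun i : ℕ × Ω => (G f u i.1 i.2)ᵀ) g (𝓝 (Matrix.of G₀)ᵀ) :=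
    ((continuous_id.matrix_transpose (m := Fin r) (n := Fin r) (R := ℝ)).tendsto _).comp hG
  have hGbG := (hGt.mul hb).mul hG
  have habG := (ha.mul hb).mul hG
  have hdiag : Tendsto (fun i : ℕ × Ω => diagonal fun k => d i.1 i.2 k ^ 2) g
      (𝓝 ((Matrix.of G₀)ᵀ * B * Matrix.of G₀)) := by
    have h1 := tendsto_of_frob_sub (A₀ := 0) (A := fun i : ℕ × Ω =>
      (diagonal fun k => d i.1 i.2 k ^ 2) - (G f u i.1 i.2)ᵀ * b i.1 * G f u i.1 i.2)
      (by simpa using (IsBigOp.tendsto_zero h.near_diag h.tendsto_rate).mono_left hg)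
    simpa using h1.add hGbG
  set w : Fin r → ℝ := fun k => ((Matrix.of G₀)ᵀ * B * Matrix.of G₀) k k with hw
  have hdw : Tendsto (fun (i : ℕ × Ω) k => d i.1 i.2 k ^ 2) g (𝓝 w) := by
    rw [tendsto_pi_nhds]
    intro k
    simpa using tendsto_matrix_iff.1 hdiag k k
  have hdw' := tendsto_diagonal_iff.2 hdw
  have e2 : diagonal w = (Matrix.of G₀)ᵀ * B * Matrix.of G₀ := tendsto_nhds_unique hdw' hdiag
  have e1 : Matrix.of G₀ * diagonal w = A * B * Matrix.of G₀ := by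
    have h1 := tendsto_of_frob_sub (A₀ := 0) (A := fun i : ℕ × Ω =>
      (G f u i.1 i.2 * diagonal fun k => d i.1 i.2 k ^ 2) -
        (f i.1 i.2)ᵀ * f i.1 i.2 * b i.1 * G f u i.1 i.2)
      (by simpa using (IsBigOp.tendsto_zero h.near_eig h.tendsto_rate).mono_left hg)
    have h2 := h1.add habG
    simp only [sub_add_cancel, zero_add] at h2
    exact tendsto_nhds_unique (hG.mul hdw') h2
  obtain ⟨c, hc, hcd⟩ := h.exists_lower_bound
  have hwpos : ∀ k, 0 < w k := fun k =>
    hc.trans_le (ge_of_tendsto (tendsto_pi_nhds.1 hdw k) (hg (by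
      filter_upwards [hcd] with i hi using hi k)))
  have hanti : Antitone w := fun j k hjk =>
    le_of_tendsto_of_tendsto (tendsto_pi_nhds.1 hdw k) (tendsto_pi_nhds.1 hdw j) (hg (by
      filter_upwards [h.eventually_isPC] with i hi
      exact pow_le_pow_left₀ (hi.nonneg k) (hi.antitone hjk) 2))
  obtain ⟨hwv, s, hs, hsQ⟩ := hQ.eq_of_eigen h.posDef_A hdist hwpos hanti e1 e2
  rw [hwv] at hdw
  refine ⟨hdw, s, hs, ?_⟩
  rw [← hsQ]
  exact tendsto_const_nhds.mul hGt

lemma tendsto_singularValues (hdist : (A * B).charpoly.roots.Nodup) {v : Fin r → ℝ}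
    {Q : Matrix (Fin r) (Fin r) ℝ} (hQ : IsCompleteDataLimit A B v Q) :
    Tendsto (fun (i : ℕ × Ω) => diagonal fun k => d i.1 i.2 k ^ 2) (probFilter μ)
      (𝓝 (diagonal v)) := by
  rw [tendsto_iff_ultrafilter]
  exact fun g hg => tendsto_diagonal_iff.2 (h.ultrafilter_limit hdist hQ g hg).1

lemma exists_signs (hdist : (A * B).charpoly.roots.Nodup) {v : Fin r → ℝ}
    {Q : Matrix (Fin r) (Fin r) ℝ} (hQ : IsCompleteDataLimit A B v Q) :
    ∃ s : ℕ × Ω → Fin r → ℝ, (∀ i k, s i k = 1 ∨ s i k = -1) ∧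
      Tendsto (fun i => diagonal (s i) * (G f u i.1 i.2)ᵀ) (probFilter μ) (𝓝 Q) :=
  exists_signs_of_ultrafilter fun g hg => (h.ultrafilter_limit hdist hQ g hg).2

end FactorApprox

/-! ### Moments of factor models -/

lemma euclNorm_sq {r : ℕ} (v : Fin r → ℝ) : euclNorm v ^ 2 = ∑ k, v k ^ 2 :=
  EuclideanSpace.real_norm_sq_eq _

lemma abs_apply_le_euclNorm {r : ℕ} (v : Fin r → ℝ) (k : Fin r) : |v k| ≤ euclNorm v := by
  refine abs_le_of_sq_le_sq ?_ (norm_nonneg _)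
  rw [euclNorm_sq]
  exact Finset.single_le_sum (f := fun k => v k ^ 2) (fun _ _ => sq_nonneg _) (Finset.mem_univ k)

lemma abs_dotProduct_le_euclNorm {r : ℕ} (v w : Fin r → ℝ) :
    |∑ k, v k * w k| ≤ euclNorm v * euclNorm w := by
  refine abs_le_of_sq_le_sq ?_ (mul_nonneg (norm_nonneg _) (norm_nonneg _))
  rw [mul_pow, euclNorm_sq, euclNorm_sq]
  exact Finset.sum_mul_sq_le_sq_mul_sq _ _ _

lemma ENNReal.holderTriple_two_mul (p : ENNReal) : ENNReal.HolderTriple (2 * p) (2 * p) p where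
  inv_add_inv_eq_inv := by
    rw [ENNReal.mul_inv (Or.inl two_ne_zero) (Or.inl ENNReal.ofNat_ne_top), ← add_mul,
      ENNReal.inv_two_add_inv_two, one_mul]

section Lp

variable {Ω : Type*} [MeasurableSpace Ω] {μ : Measure Ω}

lemma memLp_of_integrable_abs_pow {f : Ω → ℝ} (hf : AEStronglyMeasurable f μ) {p : ℕ} (hp : p ≠ 0)
    (h : Integrable (fun ω => |f ω| ^ p) μ) : MemLp f p μ := by
  refine (integrable_norm_rpow_iff hf (by simpa using hp) (ENNReal.natCast_ne_top p)).1 ?_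
  simpa using h

lemma MeasureTheory.MemLp.mul_eight {f g : Ω → ℝ} (hf : MemLp f 8 μ) (hg : MemLp g 8 μ) :
    MemLp (fun ω => f ω * g ω) 4 μ := by
  have h8 : (8 : ENNReal) = 2 * 4 := by norm_num
  rw [h8] at hf hg
  have := ENNReal.holderTriple_two_mul 4
  exact hg.mul' hf

lemma MeasureTheory.MemLp.mul_four {f g : Ω → ℝ} (hf : MemLp f 4 μ) (hg : MemLp g 4 μ) :
    MemLp (fun ω => f ω * g ω) 2 μ := by
  have h4 : (4 : ENNReal) = 2 * 2 := by norm_num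
  rw [h4] at hf hg
  have := ENNReal.holderTriple_two_mul 2
  exact hg.mul' hf

/-- Pointwise `x² ≤ 1 + |x|^p`, by comparing `|x|` with `1`. -/
lemma integral_sq_le_one_add [IsProbabilityMeasure μ] {f : Ω → ℝ} {p : ℕ} (hp : 2 ≤ p)
    (hf : MemLp f p μ) {M : ℝ} (hM : ∫ ω, |f ω| ^ p ∂μ ≤ M) : ∫ ω, f ω ^ 2 ∂μ ≤ 1 + M := by
  have h1 : Integrable (fun ω => |f ω| ^ p) μ := by
    simpa using hf.integrable_norm_pow (by omega)
  have h2 : MemLp f 2 μ := hf.mono_exponent (by exact_mod_cast hp)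
  calc ∫ ω, f ω ^ 2 ∂μ ≤ ∫ ω, (1 + |f ω| ^ p) ∂μ := by
        refine integral_mono h2.integrable_sq ((integrable_const 1).add h1) fun ω => ?_
        change f ω ^ 2 ≤ 1 + |f ω| ^ p
        rw [← sq_abs]
        rcases le_total |f ω| 1 with h | h
        · have := pow_le_one₀ (n := 2) (abs_nonneg (f ω)) h
          have := pow_nonneg (abs_nonneg (f ω)) p
          linarith
        · have := pow_le_pow_right₀ h hp
          linarith
    _ = 1 + ∫ ω, |f ω| ^ p ∂μ := by
        rw [integral_add (integrable_const 1) h1]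
        simp
    _ ≤ _ := by linarith

end Lp

/-- The entries of a matrix where the mask is true, zero elsewhere. -/
def maskMatrix {T N : ℕ} (o : Fin T → Fin N → Bool) (A : Matrix (Fin T) (Fin N) ℝ) :
    Matrix (Fin T) (Fin N) ℝ :=
  Matrix.of fun t i => if o t i = true then A t i else 0

lemma frob_maskMatrix_le {T N : ℕ} (o : Fin T → Fin N → Bool) (A : Matrix (Fin T) (Fin N) ℝ) :
    frob (maskMatrix o A) ≤ frob A := by
  refine frob_mono fun i j => ?_
  rw [maskMatrix, of_apply]
  split_ifs <;> simp

lemma maskMatrix_true {T N : ℕ} (A : Matrix (Fin T) (Fin N) ℝ) :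
    maskMatrix (fun _ _ => true) A = A := by
  ext
  simp [maskMatrix]

/-! ### Second moments of errors restricted to a set of observed cells. -/

namespace MomentBounds

variable {Ω : Type*} [MeasurableSpace Ω] {μ : Measure Ω} [IsProbabilityMeasure μ] {r : ℕ} {M : ℝ}
  {m : FactorModel Ω r} (hm : MomentBounds μ M m)
include hm

omit [IsProbabilityMeasure μ] in
lemma memLp_e (t i) : MemLp (fun ω => m.e ω t i) 8 μ := by
  exact_mod_cast memLp_of_integrable_abs_pow (p := 8) (hm.measurable_e t i).aestronglyMeasurable
    (by norm_num) (hm.integrable_e t i)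

lemma memLp_e_two (t i) : MemLp (fun ω => m.e ω t i) 2 μ :=
  (hm.memLp_e t i).mono_exponent (by norm_num)

omit [IsProbabilityMeasure μ] in
lemma memLp_e_mul (t i s j) : MemLp (fun ω => m.e ω t i * m.e ω s j) 4 μ :=
  (hm.memLp_e t i).mul_eight (hm.memLp_e s j)

lemma integrable_e_mul (t i s j) : Integrable (fun ω => m.e ω t i * m.e ω s j) μ :=
  (hm.memLp_e_mul t i s j).integrable (by norm_num)

lemma integral_e_sq_le (t i) : ∫ ω, m.e ω t i ^ 2 ∂μ ≤ 1 + M :=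
  integral_sq_le_one_add (p := 8) (by norm_num) (hm.memLp_e t i) (hm.moment_e t i)

omit [IsProbabilityMeasure μ] in
lemma nonneg (hT : 0 < m.T) (hN : 0 < m.N) : 0 ≤ M :=
  le_trans (integral_nonneg fun _ => by positivity) (hm.moment_e ⟨0, hT⟩ ⟨0, hN⟩)

lemma abs_integral_e_mul_le (t i s j) : |∫ ω, m.e ω t i * m.e ω s j ∂μ| ≤ 1 + M := by
  have h1 := hm.integral_e_sq_le t i
  have h2 := hm.integral_e_sq_le s j
  have i1 := (hm.memLp_e_two t i).integrable_sq
  have i2 := (hm.memLp_e_two s j).integrable_sq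
  calc |∫ ω, m.e ω t i * m.e ω s j ∂μ| ≤ ∫ ω, |m.e ω t i * m.e ω s j| ∂μ :=
        abs_integral_le_integral_abs
    _ ≤ ∫ ω, (m.e ω t i ^ 2 + m.e ω s j ^ 2) / 2 ∂μ := by
        refine integral_mono (hm.integrable_e_mul t i s j).abs ((i1.add i2).div_const 2) fun ω => ?_
        change |m.e ω t i * m.e ω s j| ≤ (m.e ω t i ^ 2 + m.e ω s j ^ 2) / 2
        rw [abs_mul, ← sq_abs (m.e ω t i), ← sq_abs (m.e ω s j)]
        nlinarith [sq_nonneg (|m.e ω t i| - |m.e ω s j|)]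
    _ = (∫ ω, m.e ω t i ^ 2 ∂μ + ∫ ω, m.e ω s j ^ 2 ∂μ) / 2 := by
        rw [integral_div, integral_add i1 i2]
    _ ≤ _ := by linarith

lemma integrable_frob_e : Integrable (fun ω => frob (m.e ω) ^ 2) μ := by
  simp only [frob_sq]
  exact integrable_finsetSum _ fun t _ => integrable_finsetSum _ fun i _ =>
    (hm.memLp_e_two t i).integrable_sq

lemma integral_frob_e_le : ∫ ω, frob (m.e ω) ^ 2 ∂μ ≤ (1 + M) * (m.N * m.T) := by
  simp only [frob_sq]
  rw [integral_finsetSum _ fun t _ => integrable_finsetSum _ fun i _ =>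
    (hm.memLp_e_two t i).integrable_sq]
  calc ∑ t, ∫ ω, ∑ i, m.e ω t i ^ 2 ∂μ ≤ ∑ _t : Fin m.T, ∑ _i : Fin m.N, (1 + M) := by
        refine Finset.sum_le_sum fun t _ => ?_
        rw [integral_finsetSum _ fun i _ => (hm.memLp_e_two t i).integrable_sq]
        exact Finset.sum_le_sum fun i _ => hm.integral_e_sq_le t i
    _ = _ := by
        simp
        ring

lemma memLp_mask_mul_load (o : Fin m.T → Fin m.N → Bool) (t k) :
    MemLp (fun ω => (maskMatrix o (m.e ω) * m.Λ) t k) 2 μ := by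
  simp only [Matrix.mul_apply, maskMatrix, of_apply]
  refine memLp_finsetSum _ fun i _ => ?_
  by_cases ho : o t i = true
  · simpa [ho, mul_comm] using (hm.memLp_e_two t i).const_mul (m.Λ i k)
  · simp [ho]

lemma integrable_frob_mask_mul_load (o : Fin m.T → Fin m.N → Bool) :
    Integrable (fun ω => frob (maskMatrix o (m.e ω) * m.Λ) ^ 2) μ := by
  simp only [frob_sq]
  exact integrable_finsetSum _ fun t _ => integrable_finsetSum _ fun k _ =>
    (hm.memLp_mask_mul_load o t k).integrable_sq

/-- The square expands into products of errors of two units in one period, with coefficients of size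
at most `M²`. The expectations are dominated by `τ`, whose rows sum to at most `M`. A mask only sets
coefficients to zero, so it does no harm. -/
lemma integral_frob_mask_mul_load_le (o : Fin m.T → Fin m.N → Bool) :
    ∫ ω, frob (maskMatrix o (m.e ω) * m.Λ) ^ 2 ∂μ ≤ M ^ 3 * (m.N * m.T) := by
  obtain ⟨τ, hτ, hτM⟩ := hm.cross
  have key : ∀ ω, frob (maskMatrix o (m.e ω) * m.Λ) ^ 2 = ∑ t, ∑ i, ∑ j,
      (if o t i = true ∧ o t j = true then ∑ k, m.Λ i k * m.Λ j k else 0) *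
        (m.e ω t i * m.e ω t j) := by
    intro ω
    rw [frob_sq]
    refine Finset.sum_congr rfl fun t _ => ?_
    simp only [Matrix.mul_apply, sq, Finset.sum_mul_sum]
    rw [Finset.sum_comm]
    refine Finset.sum_congr rfl fun i _ => ?_
    rw [Finset.sum_comm]
    refine Finset.sum_congr rfl fun j _ => ?_
    simp only [maskMatrix, of_apply]
    by_cases h1 : o t i = true <;> by_cases h2 : o t j = true <;> simp [h1, h2]
    rw [Finset.sum_mul]
    exact Finset.sum_congr rfl fun k _ => by ring
  simp only [key]
  have hint : ∀ t i j, Integrable (fun ω =>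
      (if o t i = true ∧ o t j = true then ∑ k, m.Λ i k * m.Λ j k else 0) *
        (m.e ω t i * m.e ω t j)) μ := fun t i j => (hm.integrable_e_mul t i t j).const_mul _
  rw [integral_finsetSum _ fun t _ => integrable_finsetSum _ fun i _ =>
    integrable_finsetSum _ fun j _ => hint t i j]
  calc _ ≤ ∑ _t : Fin m.T, ∑ _i : Fin m.N, M ^ 3 := by
        refine Finset.sum_le_sum fun t _ => ?_
        rw [integral_finsetSum _ fun i _ => integrable_finsetSum _ fun j _ => hint t i j]
        refine Finset.sum_le_sum fun i _ => ?_
        rw [integral_finsetSum _ fun j _ => hint t i j]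
        calc _ ≤ ∑ j, M ^ 2 * |τ i j| := by
              refine Finset.sum_le_sum fun j _ => ?_
              rw [integral_const_mul]
              refine (le_abs_self _).trans ?_
              rw [abs_mul]
              refine mul_le_mul ?_ (hτ i j t) (abs_nonneg _) (sq_nonneg M)
              split_ifs
              · refine (abs_dotProduct_le_euclNorm _ _).trans ?_
                rw [sq]
                exact mul_le_mul (hm.bound_Λ i) (hm.bound_Λ j) (norm_nonneg _)
                  ((norm_nonneg _).trans (hm.bound_Λ i))
              · simpa using sq_nonneg M
          _ = M ^ 2 * ∑ j, |τ i j| := by rw [Finset.mul_sum]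
          _ ≤ M ^ 2 * M := mul_le_mul_of_nonneg_left (hτM i) (sq_nonneg M)
          _ = M ^ 3 := by ring
    _ = _ := by
        simp
        ring

omit [IsProbabilityMeasure μ] in
lemma memLp_F (t k) : MemLp (fun ω => m.F ω t k) 4 μ := by
  refine memLp_of_integrable_abs_pow (p := 4) (hm.measurable_F t k).aestronglyMeasurable
    (by norm_num) ?_
  refine (hm.integrable_F t).mono' ?_ (ae_of_all _ fun ω => ?_)
  · exact ((hm.measurable_F t k).abs.pow_const 4).aestronglyMeasurable
  · rw [Real.norm_of_nonneg (by positivity)]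
    exact pow_le_pow_left₀ (abs_nonneg _) (abs_apply_le_euclNorm _ k) 4

lemma memLp_factor_error (i k) : MemLp (fun ω => ((m.e ω)ᵀ * m.F ω) i k) 2 μ := by
  simp only [Matrix.mul_apply, transpose_apply]
  exact memLp_finsetSum _ fun t _ =>
    ((hm.memLp_e t i).mono_exponent (by norm_num)).mul_four (hm.memLp_F t k)

lemma integrable_frob_factor_error : Integrable (fun ω => frob ((m.e ω)ᵀ * m.F ω) ^ 2) μ := by
  simp only [frob_sq]
  exact integrable_finsetSum _ fun i _ => integrable_finsetSum _ fun k _ =>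
    (hm.memLp_factor_error i k).integrable_sq

omit [IsProbabilityMeasure μ] in
lemma integral_frob_factor_error_le (hT : 0 < m.T) (hN : 0 < m.N) :
    ∫ ω, frob ((m.e ω)ᵀ * m.F ω) ^ 2 ∂μ ≤ M * (m.N * m.T) := by
  have h1 : ∀ ω, (1 / (m.N : ℝ)) * ∑ i,
      euclNorm (fun k => (1 / √(m.T : ℝ)) * ∑ t, m.F ω t k * m.e ω t i) ^ 2
      = (1 / ((m.N : ℝ) * m.T)) * frob ((m.e ω)ᵀ * m.F ω) ^ 2 := by
    intro ω
    have h2 : (1 / √(m.T : ℝ)) ^ 2 = 1 / m.T := by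
      rw [div_pow, one_pow, Real.sq_sqrt (Nat.cast_nonneg _)]
    have h3 : (1 / ((m.N : ℝ) * m.T)) = 1 / m.N * (1 / m.T) := (one_div_mul_one_div _ _).symm
    rw [frob_sq, h3, mul_assoc]
    congr 1
    rw [Finset.mul_sum]
    refine Finset.sum_congr rfl fun i _ => ?_
    rw [euclNorm_sq, Finset.mul_sum]
    refine Finset.sum_congr rfl fun k _ => ?_
    rw [mul_pow, h2, Matrix.mul_apply]
    simp only [transpose_apply, mul_comm]
  have h2 := hm.factor_error
  simp only [h1] at h2
  rw [integral_const_mul, one_div, inv_mul_le_iff₀ (by positivity)] at h2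
  linarith

/-- The second moment of `(o ∘ e)(o ∘ e)ᵀ` for a mask `o`. -/
lemma integral_frob_mask_mul_transpose_le {K : ℝ} (hT : 0 < m.T) (hN : 0 < m.N)
    (o : Fin m.T → Fin m.N → Bool)
    (hcent : ∀ t s, ∫ ω, (∑ i with o t i = true ∧ o s i = true,
      (m.e ω s i * m.e ω t i - ∫ ω', m.e ω' s i * m.e ω' t i ∂μ)) ^ 2 ∂μ ≤ K * m.N) :
    Integrable (fun ω => frob (maskMatrix o (m.e ω) * (maskMatrix o (m.e ω))ᵀ) ^ 2) μ ∧
    ∫ ω, frob (maskMatrix o (m.e ω) * (maskMatrix o (m.e ω))ᵀ) ^ 2 ∂μ ≤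
      2 * K * (m.T ^ 2 * m.N) + 2 * (1 + M) * M * (m.N ^ 2 * m.T) := by
  have hM := hm.nonneg hT hN
  set I : Fin m.T → Fin m.T → Finset (Fin m.N) := fun t s =>
    Finset.univ.filter fun i => o t i = true ∧ o s i = true with hI
  have key : ∀ ω t s, (maskMatrix o (m.e ω) * (maskMatrix o (m.e ω))ᵀ) t s
      = ∑ i ∈ I t s, m.e ω s i * m.e ω t i := by
    intro ω t s
    rw [Matrix.mul_apply, hI, Finset.sum_filter]
    refine Finset.sum_congr rfl fun i _ => ?_
    simp only [maskMatrix, of_apply, transpose_apply]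
    by_cases h1 : o t i = true <;> by_cases h2 : o s i = true <;> simp [h1, h2, mul_comm]
  have hS : ∀ t s, MemLp (fun ω => ∑ i ∈ I t s, m.e ω s i * m.e ω t i) 2 μ := fun t s =>
    memLp_finsetSum _ fun i _ => (hm.memLp_e_mul s i t i).mono_exponent (by norm_num)
  have hC : ∀ t s, MemLp (fun ω => ∑ i ∈ I t s,
      (m.e ω s i * m.e ω t i - ∫ ω', m.e ω' s i * m.e ω' t i ∂μ)) 2 μ := fun t s =>
    memLp_finsetSum _ fun i _ =>
      ((hm.memLp_e_mul s i t i).mono_exponent (by norm_num)).sub (memLp_const _)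
  simp only [frob_sq, key]
  have hint : ∀ t s, Integrable (fun ω => (∑ i ∈ I t s, m.e ω s i * m.e ω t i) ^ 2) μ :=
    fun t s => (hS t s).integrable_sq
  refine ⟨integrable_finsetSum _ fun t _ => integrable_finsetSum _ fun s _ => hint t s, ?_⟩
  rw [integral_finsetSum _ fun t _ => integrable_finsetSum _ fun s _ => hint t s]
  have hts : ∀ t s, ∫ ω, (∑ i ∈ I t s, m.e ω s i * m.e ω t i) ^ 2 ∂μ ≤
      2 * (K * m.N) + 2 * ((1 + M) * m.N) * ∑ i, |∫ ω, m.e ω t i * m.e ω s i ∂μ| := by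
    intro t s
    set c := ∑ i ∈ I t s, ∫ ω', m.e ω' s i * m.e ω' t i ∂μ with hc
    have hc1 : |c| ≤ ∑ i, |∫ ω, m.e ω t i * m.e ω s i ∂μ| := by
      refine (Finset.abs_sum_le_sum_abs _ _).trans ?_
      simp only [mul_comm (m.e _ s _)]
      exact Finset.sum_le_sum_of_subset_of_nonneg (Finset.subset_univ _) fun _ _ _ => abs_nonneg _
    have hc2 : |c| ≤ (1 + M) * m.N := by
      refine hc1.trans ((Finset.sum_le_sum fun i _ => hm.abs_integral_e_mul_le t i s i).trans ?_)
      simp only [Finset.sum_const, Finset.card_univ, Fintype.card_fin, nsmul_eq_mul]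
      rw [mul_comm]
    -- One factor of `c²` gets the crude bound of order `N`; the other is kept as a sum of absolute
    -- moments, so that the sum over `t` and `s` is still controlled by the joint condition.
    have hc3 : c ^ 2 ≤ (1 + M) * m.N * ∑ i, |∫ ω, m.e ω t i * m.e ω s i ∂μ| := by
      rw [← sq_abs, sq]
      exact mul_le_mul hc2 hc1 (abs_nonneg _) (by positivity)
    have hc4 := hcent t s
    have i1 := (hC t s).integrable_sq
    calc ∫ ω, (∑ i ∈ I t s, m.e ω s i * m.e ω t i) ^ 2 ∂μ
        ≤ ∫ ω, (2 * (∑ i ∈ I t s,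
            (m.e ω s i * m.e ω t i - ∫ ω', m.e ω' s i * m.e ω' t i ∂μ)) ^ 2 + 2 * c ^ 2) ∂μ := by
          refine integral_mono (hint t s) ((i1.const_mul 2).add (integrable_const _)) fun ω => ?_
          change (∑ i ∈ I t s, m.e ω s i * m.e ω t i) ^ 2 ≤ 2 * (∑ i ∈ I t s,
            (m.e ω s i * m.e ω t i - ∫ ω', m.e ω' s i * m.e ω' t i ∂μ)) ^ 2 + 2 * c ^ 2
          rw [Finset.sum_sub_distrib, ← hc]
          nlinarith [sq_nonneg (∑ i ∈ I t s, m.e ω s i * m.e ω t i - 2 * c)]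
      _ = 2 * (∫ ω, (∑ i ∈ I t s,
            (m.e ω s i * m.e ω t i - ∫ ω', m.e ω' s i * m.e ω' t i ∂μ)) ^ 2 ∂μ) + 2 * c ^ 2 := by
          rw [integral_add (i1.const_mul 2) (integrable_const _), integral_const_mul]
          simp
      _ ≤ _ := by linarith
  -- Of the double sum over units in the joint condition only the terms with equal units are kept.
  have hjoint : ∑ t, ∑ s, ∑ i, |∫ ω, m.e ω t i * m.e ω s i ∂μ| ≤ M * (m.N * m.T) := by
    have h1 := hm.joint
    rw [one_div, inv_mul_le_iff₀ (by positivity)] at h1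
    have h2 : ∑ t, ∑ s, ∑ i, |∫ ω, m.e ω t i * m.e ω s i ∂μ|
        = ∑ i, ∑ t, ∑ s, |∫ ω, m.e ω t i * m.e ω s i ∂μ| := by
      rw [Finset.sum_congr rfl fun t _ => Finset.sum_comm]
      exact Finset.sum_comm
    rw [h2]
    refine (Finset.sum_le_sum fun i _ => ?_).trans (h1.trans_eq (by ring))
    exact Finset.single_le_sum
      (f := fun j => ∑ t, ∑ s, |∫ ω, m.e ω t i * m.e ω s j ∂μ|)
      (fun _ _ => Finset.sum_nonneg fun _ _ => Finset.sum_nonneg fun _ _ => abs_nonneg _)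
      (Finset.mem_univ i)
  calc _ ≤ ∑ t, ∑ s, (2 * (K * m.N) +
        2 * ((1 + M) * m.N) * ∑ i, |∫ ω, m.e ω t i * m.e ω s i ∂μ|) := by
        refine Finset.sum_le_sum fun t _ => ?_
        rw [integral_finsetSum _ fun s _ => hint t s]
        exact Finset.sum_le_sum fun s _ => hts t s
    _ = 2 * K * (m.T ^ 2 * m.N) + 2 * ((1 + M) * m.N) *
        ∑ t, ∑ s, ∑ i, |∫ ω, m.e ω t i * m.e ω s i ∂μ| := by
        simp only [Finset.sum_add_distrib, ← Finset.mul_sum]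
        simp
        ring
    _ ≤ 2 * K * (m.T ^ 2 * m.N) + 2 * ((1 + M) * m.N) * (M * (m.N * m.T)) := by
        gcongr
    _ = _ := by ring

/-- A fourth moment bound for a normalized centred sum bounds its second moment. -/
lemma integral_centred_sq_le {C c : ℝ} (hc : 0 < c) (I : Finset (Fin m.N)) (t s)
    (h : ∫ ω, |(1 / √c) * ∑ i ∈ I,
      (m.e ω s i * m.e ω t i - ∫ ω', m.e ω' s i * m.e ω' t i ∂μ)| ^ 4 ∂μ ≤ C) :
    ∫ ω, (∑ i ∈ I, (m.e ω s i * m.e ω t i - ∫ ω', m.e ω' s i * m.e ω' t i ∂μ)) ^ 2 ∂μ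
      ≤ (1 + C) * c := by
  have h4 : MemLp (fun ω => (1 / √c) * ∑ i ∈ I,
      (m.e ω s i * m.e ω t i - ∫ ω', m.e ω' s i * m.e ω' t i ∂μ)) 4 μ :=
    (memLp_finsetSum _ fun i _ => (hm.memLp_e_mul s i t i).sub (memLp_const _)).const_mul _
  have h1 := integral_sq_le_one_add (p := 4) (by norm_num) h4 h
  have h2 : (1 / √c) ^ 2 = c⁻¹ := by
    rw [div_pow, Real.sq_sqrt hc.le]
    simp
  simp only [mul_pow, h2] at h1
  rw [integral_const_mul, inv_mul_le_iff₀ hc] at h1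
  linarith

end MomentBounds

/-! ### Complete-data estimates -/

/-- The squared rate `ρ n ^ 2` dominates `1 / T n`, and `T n` is eventually positive. -/
def DominatesInv (ρ : ℕ → ℝ) (T : ℕ → ℕ) : Prop :=
  ∀ᶠ n in atTop, 0 < T n ∧ 1 / (T n : ℝ) ≤ ρ n ^ 2

namespace FactorModel

variable {Ω : Type*} {r : ℕ}

/-- The factors divided by `√T`. -/
noncomputable def scaledF (m : FactorModel Ω r) (ω : Ω) : Matrix (Fin m.T) (Fin r) ℝ :=
  (1 / √(m.T : ℝ)) • m.F ω

/-- The loadings divided by `√N`. -/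
noncomputable def scaledΛ (m : FactorModel Ω r) : Matrix (Fin m.N) (Fin r) ℝ :=
  (1 / √(m.N : ℝ)) • m.Λ

/-- The errors divided by `√(NT)`. -/
noncomputable def scaledE (m : FactorModel Ω r) (ω : Ω) : Matrix (Fin m.T) (Fin m.N) ℝ :=
  (1 / √((m.N : ℝ) * m.T)) • m.e ω

lemma one_div_sqrt_mul_self (c : ℕ) : 1 / √(c : ℝ) * (1 / √(c : ℝ)) = 1 / c := by
  rw [one_div_mul_one_div, Real.mul_self_sqrt (Nat.cast_nonneg c)]

lemma scaledX_eq (m : FactorModel Ω r) (ω : Ω) :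
    (1 / √((m.N : ℝ) * m.T)) • m.X ω = m.scaledF ω * m.scaledΛᵀ + m.scaledE ω := by
  rw [FactorModel.X, smul_add, scaledF, scaledΛ, scaledE, transpose_smul, Matrix.smul_mul,
    Matrix.mul_smul, smul_smul, Real.sqrt_mul (Nat.cast_nonneg _), mul_comm √(m.N : ℝ),
    ← one_div_mul_one_div]

end FactorModel

lemma maskMatrix_smul {T N : ℕ} (o : Fin T → Fin N → Bool) (c : ℝ) (A : Matrix (Fin T) (Fin N) ℝ) :
    maskMatrix o (c • A) = c • maskMatrix o A := by
  ext t i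
  simp [maskMatrix]

/-! ### Stochastic orders of the scaled errors. -/

section OneSample

variable {Ω : Type*} [MeasurableSpace Ω] {μ : Measure Ω} [IsProbabilityMeasure μ] {r : ℕ}
  {ρ : ℕ → ℝ} {m : ℕ → FactorModel Ω r}

lemma DominatesInv.pos {T : ℕ → ℕ} (hρ : ∀ n, 0 ≤ ρ n) (h : DominatesInv ρ T) :
    ∀ᶠ n in atTop, 0 < ρ n := by
  filter_upwards [h] with n hn
  refine lt_of_le_of_ne (hρ n) fun h0 => ?_
  have h1 : 0 < 1 / (T n : ℝ) := one_div_pos.2 (Nat.cast_pos.2 hn.1)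
  rw [← h0] at hn
  linarith [hn.2]

lemma bddInProb_scaledE {M : ℝ} (hM : ∀ n, MomentBounds μ M (m n)) :
    BddInProb μ fun n ω => (m n).scaledE ω := by
  have h1 : ∀ n ω, frob ((m n).scaledE ω) ^ 2
      = 1 / ((m n).N * (m n).T : ℝ) * frob ((m n).e ω) ^ 2 := by
    intro n ω
    rw [FactorModel.scaledE, frob_smul, mul_pow, sq_abs, div_pow, one_pow,
      Real.sq_sqrt (by positivity)]
  refine IsBigOp.of_integral_sq (K := |1 + M|) (Eventually.of_forall fun _ => zero_lt_one)
    (Eventually.of_forall fun n => ?_) (Eventually.of_forall fun n => ?_)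
  · simp only [h1]
    exact (hM n).integrable_frob_e.const_mul _
  · simp only [h1]
    rw [integral_const_mul]
    have h2 : ∫ ω, frob ((m n).e ω) ^ 2 ∂μ ≤ |1 + M| * ((m n).N * (m n).T) :=
      (hM n).integral_frob_e_le.trans
        (mul_le_mul_of_nonneg_right (le_abs_self _) (by positivity))
    -- For an empty panel `1 / 0 = 0` makes the left side zero, so no condition on the sizes is
    -- needed.
    rcases eq_or_lt_of_le (show (0 : ℝ) ≤ (m n).N * (m n).T by positivity) with h0 | h0
    · rw [← h0]
      simp
    · rw [one_div, inv_mul_le_iff₀ h0]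
      linarith

lemma bigOp_scaledE_transpose_mul_scaledF {M : ℝ} (hM : ∀ n, MomentBounds μ M (m n))
    (hρ : ∀ n, 0 ≤ ρ n) (hT : DominatesInv ρ fun n => (m n).T)
    (hN : DominatesInv ρ fun n => (m n).N) :
    IsBigOp μ (fun n ω => frob (((m n).scaledE ω)ᵀ * (m n).scaledF ω)) ρ := by
  have h1 : ∀ n ω, frob (((m n).scaledE ω)ᵀ * (m n).scaledF ω) ^ 2
      = 1 / ((m n).N * (m n).T : ℝ) * (1 / (m n).T) * frob (((m n).e ω)ᵀ * (m n).F ω) ^ 2 := by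
    intro n ω
    rw [FactorModel.scaledE, FactorModel.scaledF, transpose_smul, Matrix.smul_mul, Matrix.mul_smul,
      frob_smul, frob_smul, mul_pow, mul_pow, sq_abs, sq_abs, div_pow, one_pow, div_pow, one_pow,
      Real.sq_sqrt (by positivity), Real.sq_sqrt (by positivity), mul_assoc]
  refine IsBigOp.of_integral_sq (K := M) (hT.pos hρ)
    (Eventually.of_forall fun n => ?_) ?_
  · simp only [h1]
    exact (hM n).integrable_frob_factor_error.const_mul _
  · filter_upwards [hT, hN] with n hTn hNn
    simp only [h1]
    rw [integral_const_mul]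
    have hT0 : (0 : ℝ) < (m n).T := Nat.cast_pos.2 hTn.1
    have hN0 : (0 : ℝ) < (m n).N := Nat.cast_pos.2 hNn.1
    have hM0 := (hM n).nonneg hTn.1 hNn.1
    calc _ ≤ 1 / ((m n).N * (m n).T : ℝ) * (1 / (m n).T) * (M * ((m n).N * (m n).T)) :=
          mul_le_mul_of_nonneg_left ((hM n).integral_frob_factor_error_le hTn.1 hNn.1)
            (by positivity)
      _ = M * (1 / (m n).T) := by
          field_simp
      _ ≤ _ := mul_le_mul_of_nonneg_left hTn.2 hM0

lemma bigOp_mask_scaledE_mul_scaledΛ {M : ℝ} (hM : ∀ n, MomentBounds μ M (m n))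
    (hρ : ∀ n, 0 ≤ ρ n) (hT : DominatesInv ρ fun n => (m n).T)
    (hN : DominatesInv ρ fun n => (m n).N) (o : ∀ n, Fin (m n).T → Fin (m n).N → Bool) :
    IsBigOp μ (fun n ω => frob (maskMatrix (o n) ((m n).scaledE ω) * (m n).scaledΛ)) ρ := by
  have h1 : ∀ n ω, frob (maskMatrix (o n) ((m n).scaledE ω) * (m n).scaledΛ) ^ 2
      = 1 / ((m n).N * (m n).T : ℝ) * (1 / (m n).N) *
        frob (maskMatrix (o n) ((m n).e ω) * (m n).Λ) ^ 2 := by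
    intro n ω
    rw [FactorModel.scaledE, FactorModel.scaledΛ, maskMatrix_smul, Matrix.smul_mul, Matrix.mul_smul,
      frob_smul, frob_smul, mul_pow, mul_pow, sq_abs, sq_abs, div_pow, one_pow, div_pow, one_pow,
      Real.sq_sqrt (by positivity), Real.sq_sqrt (by positivity), mul_assoc]
  refine IsBigOp.of_integral_sq (K := M ^ 3) (hT.pos hρ)
    (Eventually.of_forall fun n => ?_) ?_
  · simp only [h1]
    exact ((hM n).integrable_frob_mask_mul_load (o n)).const_mul _
  · filter_upwards [hT, hN] with n hTn hNn
    simp only [h1]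
    rw [integral_const_mul]
    have hT0 : (0 : ℝ) < (m n).T := Nat.cast_pos.2 hTn.1
    have hN0 : (0 : ℝ) < (m n).N := Nat.cast_pos.2 hNn.1
    have hM0 := (hM n).nonneg hTn.1 hNn.1
    calc _ ≤ 1 / ((m n).N * (m n).T : ℝ) * (1 / (m n).N) * (M ^ 3 * ((m n).N * (m n).T)) :=
          mul_le_mul_of_nonneg_left ((hM n).integral_frob_mask_mul_load_le (o n))
            (by positivity)
      _ = M ^ 3 * (1 / (m n).N) := by
          field_simp
      _ ≤ _ := mul_le_mul_of_nonneg_left hNn.2 (by positivity)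

/-- After division by `(NT)²` the two parts of the second moment are of order `1/N` (centred sums)
and `1/T` (means), both dominated by `ρ²`. -/
lemma bigOp_mask_scaledE_mul_transpose {M K : ℝ} (hM : ∀ n, MomentBounds μ M (m n))
    (hρ : ∀ n, 0 ≤ ρ n) (hT : DominatesInv ρ fun n => (m n).T)
    (hN : DominatesInv ρ fun n => (m n).N) (o : ∀ n, Fin (m n).T → Fin (m n).N → Bool)
    (hK : 0 ≤ K)
    (hcent : ∀ᶠ n in atTop, ∀ t s, ∫ ω, (∑ i with o n t i = true ∧ o n s i = true,
      ((m n).e ω s i * (m n).e ω t i - ∫ ω', (m n).e ω' s i * (m n).e ω' t i ∂μ)) ^ 2 ∂μ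
        ≤ K * (m n).N) :
    IsBigOp μ (fun n ω => frob (maskMatrix (o n) ((m n).scaledE ω) *
      (maskMatrix (o n) ((m n).scaledE ω))ᵀ)) ρ := by
  have h1 : ∀ n ω, frob (maskMatrix (o n) ((m n).scaledE ω) *
      (maskMatrix (o n) ((m n).scaledE ω))ᵀ) ^ 2
      = (1 / ((m n).N * (m n).T : ℝ)) ^ 2 *
        frob (maskMatrix (o n) ((m n).e ω) * (maskMatrix (o n) ((m n).e ω))ᵀ) ^ 2 := by
    intro n ω
    have h2 : (1 / √((m n).N * (m n).T : ℝ)) * (1 / √((m n).N * (m n).T : ℝ))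
        = 1 / ((m n).N * (m n).T : ℝ) := by
      exact_mod_cast FactorModel.one_div_sqrt_mul_self ((m n).N * (m n).T)
    rw [FactorModel.scaledE, maskMatrix_smul, transpose_smul, Matrix.smul_mul, Matrix.mul_smul,
      smul_smul, frob_smul, mul_pow, sq_abs, h2]
  refine IsBigOp.of_integral_sq (K := 2 * K + 2 * (1 + M) * M) (hT.pos hρ) ?_ ?_
  · filter_upwards [hT, hN, hcent] with n hTn hNn hc
    simp only [h1]
    exact ((hM n).integral_frob_mask_mul_transpose_le hTn.1 hNn.1 (o n) hc).1.const_mul _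
  · filter_upwards [hT, hN, hcent] with n hTn hNn hc
    simp only [h1]
    rw [integral_const_mul]
    have hT0 : (0 : ℝ) < (m n).T := Nat.cast_pos.2 hTn.1
    have hN0 : (0 : ℝ) < (m n).N := Nat.cast_pos.2 hNn.1
    have hM0 := (hM n).nonneg hTn.1 hNn.1
    calc _ ≤ (1 / ((m n).N * (m n).T : ℝ)) ^ 2 * (2 * K * ((m n).T ^ 2 * (m n).N) +
          2 * (1 + M) * M * ((m n).N ^ 2 * (m n).T)) :=
          mul_le_mul_of_nonneg_left
            ((hM n).integral_frob_mask_mul_transpose_le hTn.1 hNn.1 (o n) hc).2 (by positivity)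
      _ = 2 * K * (1 / (m n).N) + 2 * (1 + M) * M * (1 / (m n).T) := by
          field_simp
      _ ≤ 2 * K * ρ n ^ 2 + 2 * (1 + M) * M * ρ n ^ 2 :=
          add_le_add (mul_le_mul_of_nonneg_left hNn.2 (by positivity))
            (mul_le_mul_of_nonneg_left hTn.2 (by positivity))
      _ = _ := by ring

end OneSample

namespace AssumptionA

variable {Ω : Type*} [MeasurableSpace Ω] {μ : Measure Ω} {r : ℕ} {m : ℕ → FactorModel Ω r}
  {SF SΛ : Matrix (Fin r) (Fin r) ℝ} (h : AssumptionA μ m SF SΛ)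
include h

lemma tendsto_scaledF : Tendsto (fun i : ℕ × Ω =>
    ((m i.1).scaledF i.2)ᵀ * (m i.1).scaledF i.2) (probFilter μ) (𝓝 SF) := by
  refine (tendstoInProb_iff_probFilter.1 h.tendsto_F).congr fun i => ?_
  rw [FactorModel.scaledF, transpose_smul, Matrix.smul_mul, Matrix.mul_smul, smul_smul,
    FactorModel.one_div_sqrt_mul_self]

lemma tendsto_scaledΛ : Tendsto (fun n => (m n).scaledΛᵀ * (m n).scaledΛ) atTop (𝓝 SΛ) := by
  refine h.tendsto_Λ.congr fun n => ?_
  rw [FactorModel.scaledΛ, transpose_smul, Matrix.smul_mul, Matrix.mul_smul, smul_smul,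
    FactorModel.one_div_sqrt_mul_self]

lemma bdd_scaledF : BddInProb μ fun n ω => (m n).scaledF ω := by
  have h1 : Continuous fun A : Matrix (Fin r) (Fin r) ℝ => √A.trace := by fun_prop
  refine IsBigOp.of_tendsto (c := √SF.trace)
    (((h1.tendsto SF).comp h.tendsto_scaledF).congr fun i => ?_)
  rw [Function.comp, ← frob_sq_eq_trace, Real.sqrt_sq (frob_nonneg _)]

lemma bdd_scaledΛ : BddInProb μ fun n (_ : Ω) => (m n).scaledΛ := by
  have h1 : Continuous fun A : Matrix (Fin r) (Fin r) ℝ => √A.trace := by fun_prop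
  refine IsBigOp.of_tendsto (c := √SΛ.trace) ((((h1.tendsto SΛ).comp h.tendsto_scaledΛ).comp
    tendsto_fst_probFilter).congr fun i => ?_)
  rw [Function.comp, Function.comp, ← frob_sq_eq_trace, Real.sqrt_sq (frob_nonneg _)]

end AssumptionA

/-! ### From small errors to imputed common components. -/

section Algebra

variable {Ω : Type*} [MeasurableSpace Ω] {μ : Measure Ω} {r : ℕ} {ρ : ℕ → ℝ}

/-- If the error `ε` of a factor structure `f lᵀ` is small, then `x xᵀ` is close to
`f lᵀ l fᵀ`. -/
lemma near_of_error {T N : ℕ → ℕ} (hρ : ∀ n, 0 ≤ ρ n)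
    {f : ∀ n, Ω → Matrix (Fin (T n)) (Fin r) ℝ} {l : ∀ n, Matrix (Fin (N n)) (Fin r) ℝ}
    {ε : ∀ n, Ω → Matrix (Fin (T n)) (Fin (N n)) ℝ} (hf : BddInProb μ f)
    (h1 : IsBigOp μ (fun n ω => frob (ε n ω * l n)) ρ)
    (h2 : IsBigOp μ (fun n ω => frob (ε n ω * (ε n ω)ᵀ)) ρ) :
    Near μ ρ (fun n ω => (f n ω * (l n)ᵀ + ε n ω) * (f n ω * (l n)ᵀ + ε n ω)ᵀ)
      fun n ω => f n ω * ((l n)ᵀ * l n) * (f n ω)ᵀ := by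
  have h3 := IsBigOp.frob_mul_right hρ h1 hf.transpose
  refine ((h3.frob_add h3.frob_transpose).frob_add h2).frob_le
    (Eventually.of_forall fun i => le_of_eq ?_)
  congr 1
  simp only [transpose_add, transpose_mul, transpose_transpose, Matrix.add_mul, Matrix.mul_add,
    Matrix.mul_assoc]
  abel

variable {T N : ℕ → ℕ} {A B : Matrix (Fin r) (Fin r) ℝ}
  {f : ∀ n, Ω → Matrix (Fin (T n)) (Fin r) ℝ}
  {b : ℕ → Matrix (Fin r) (Fin r) ℝ} {x : ∀ n, Ω → Matrix (Fin (T n)) (Fin (N n)) ℝ}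
  {u : ∀ n, Ω → Matrix (Fin (T n)) (Fin r) ℝ} {d : ℕ → Ω → Fin r → ℝ}

/-- The estimated loadings of units with loadings `l` and errors `ε` are close to `l G`. -/
lemma FactorApprox.near_loadings (h : FactorApprox μ ρ A B f b x u d) {N' : ℕ → ℕ}
    {l : ∀ n, Matrix (Fin (N' n)) (Fin r) ℝ} {ε : ∀ n, Ω → Matrix (Fin (T n)) (Fin (N' n)) ℝ}
    (hε : BddInProb μ ε) (hεf : IsBigOp μ (fun n ω => frob ((ε n ω)ᵀ * f n ω)) ρ) :
    Near μ ρ (fun n ω => (f n ω * (l n)ᵀ + ε n ω)ᵀ * u n ω)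
      fun n ω => l n * FactorApprox.G f u n ω := by
  -- Since `u` depends on the errors, `εᵀ u` is split as `εᵀ (u - f H) + (εᵀ f) H`: in the first
  -- term `ε` is merely bounded and `u - f H` is small, in the second `εᵀ f` is small.
  have h1 := IsBigOp.frob_mul_left h.rate_nonneg h.near_u hε.transpose
  have h2 := IsBigOp.frob_mul_right h.rate_nonneg hεf h.bdd_H
  refine (h1.frob_add h2).frob_le (Eventually.of_forall fun i => le_of_eq ?_)
  congr 1
  simp only [FactorApprox.G, transpose_add, transpose_mul, transpose_transpose, Matrix.add_mul,
    Matrix.mul_sub, Matrix.mul_assoc]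
  abel

section Imputation

variable {Gt Ht Gw Hw K : ℕ → Ω → Matrix (Fin r) (Fin r) ℝ} {No : ℕ → ℕ}
  {lo : ∀ n, Matrix (Fin (No n)) (Fin r) ℝ}

/-- An approximate inverse of the second moment matrix of rotated loadings. -/
lemma near_gram_mul_inverse (hρ : ∀ n, 0 ≤ ρ n) (hlo : BddInProb μ fun n _ => lo n)
    (hK : BddInProb μ K) (hGw : BddInProb μ Gw) (hHw : BddInProb μ Hw)
    (hbK : Near μ ρ (fun n ω => (lo n)ᵀ * lo n * K n ω) fun _ _ => 1)
    (hGHw : Near μ ρ (fun n ω => (Gw n ω)ᵀ * Hw n ω) fun _ _ => 1)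
    (hHGw : Near μ ρ (fun n ω => Hw n ω * (Gw n ω)ᵀ) fun _ _ => 1) :
    Near μ ρ (fun n ω => (lo n * Gw n ω)ᵀ * (lo n * Gw n ω) * ((Hw n ω)ᵀ * K n ω * Hw n ω))
      fun _ _ => 1 := by
  -- Three cancellations, from the inside outwards: `Gw Hwᵀ ≈ 1`, then `loᵀ lo K ≈ 1`, then `Gwᵀ Hw
  -- ≈ 1`.
  have e1 := ((hHGw.transpose.mul_right hρ (hK.mul hHw)).mul_left hρ
    (hlo.transpose.mul hlo)).mul_left hρ hGw.transpose
  have e2 := (hbK.mul_right hρ hHw).mul_left hρ hGw.transpose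
  have e3 : Near μ ρ
      (fun n ω => (lo n * Gw n ω)ᵀ * (lo n * Gw n ω) * ((Hw n ω)ᵀ * K n ω * Hw n ω))
      fun n ω => (Gw n ω)ᵀ * ((lo n)ᵀ * lo n * K n ω * Hw n ω) :=
    e1.congr' (Eventually.of_forall fun i => by
        simp only [transpose_mul, transpose_transpose, Matrix.mul_assoc])
      (Eventually.of_forall fun i => by
        simp only [transpose_one, Matrix.mul_assoc, Matrix.one_mul])
  have e4 : Near μ ρ (fun n ω => (Gw n ω)ᵀ * ((lo n)ᵀ * lo n * K n ω * Hw n ω))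
      fun n ω => (Gw n ω)ᵀ * Hw n ω :=
    e2.congr' (Eventually.of_forall fun i => rfl)
      (Eventually.of_forall fun i => by simp only [Matrix.one_mul])
  exact (e3.trans e4).trans hGHw

/-- The regression coefficients of loadings close to `lo Gt` on loadings close to `lo Gw`. -/
lemma near_regression (hρ : ∀ n, 0 ≤ ρ n) (hρ0 : Tendsto ρ atTop (𝓝 0))
    (hlo : BddInProb μ fun n _ => lo n) (hK : BddInProb μ K) (hGt : BddInProb μ Gt)
    (hGw : BddInProb μ Gw) (hHw : BddInProb μ Hw)
    (hbK : Near μ ρ (fun n ω => (lo n)ᵀ * lo n * K n ω) fun _ _ => 1)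
    (hGHw : Near μ ρ (fun n ω => (Gw n ω)ᵀ * Hw n ω) fun _ _ => 1)
    (hHGw : Near μ ρ (fun n ω => Hw n ω * (Gw n ω)ᵀ) fun _ _ => 1)
    {lt lw : ∀ n, Ω → Matrix (Fin (No n)) (Fin r) ℝ}
    (hlt : Near μ ρ lt fun n ω => lo n * Gt n ω) (hlw : Near μ ρ lw fun n ω => lo n * Gw n ω) :
    Near μ ρ (fun n ω => ((lt n ω)ᵀ * lw n ω) * ((lw n ω)ᵀ * lw n ω)⁻¹)
      fun n ω => (Gt n ω)ᵀ * Hw n ω := by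
  have hloGt : BddInProb μ fun n ω => lo n * Gt n ω := hlo.mul hGt
  have hloGw : BddInProb μ fun n ω => lo n * Gw n ω := hlo.mul hGw
  have hXb : BddInProb μ fun n ω => (Hw n ω)ᵀ * K n ω * Hw n ω := (hHw.transpose.mul hK).mul hHw
  have hR : Near μ ρ (fun n ω => (lt n ω)ᵀ * lw n ω)
      fun n ω => (lo n * Gt n ω)ᵀ * (lo n * Gw n ω) :=
    hlt.transpose.mul hρ hρ0 hlw hloGt.transpose hloGw
  have hP : Near μ ρ (fun n ω => (lw n ω)ᵀ * lw n ω)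
      fun n ω => (lo n * Gw n ω)ᵀ * (lo n * Gw n ω) :=
    hlw.transpose.mul hρ hρ0 hlw hloGw.transpose hloGw
  obtain ⟨hPu, hPi⟩ := ((hP.mul_right hρ hXb).trans
    (near_gram_mul_inverse hρ hlo hK hGw hHw hbK hGHw hHGw)).inverse hρ0 hXb
  -- Instead of a limit of the inverse, the normal equations are verified: `Gtᵀ Hw` times the Gram
  -- matrix is near `ltᵀ lw`, because `Hw Gwᵀ ≈ 1`. Multiplication by the bounded inverse then
  -- yields the coefficients.
  have e1 := hP.mul_left hρ (hGt.transpose.mul hHw)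
  have e2 := (hHGw.mul_right hρ ((hlo.transpose.mul hlo).mul hGw)).mul_left hρ hGt.transpose
  have e3 : Near μ ρ (fun n ω => (Gt n ω)ᵀ * Hw n ω * ((lo n * Gw n ω)ᵀ * (lo n * Gw n ω)))
      fun n ω => (lo n * Gt n ω)ᵀ * (lo n * Gw n ω) :=
    e2.congr' (Eventually.of_forall fun i => by simp only [transpose_mul, Matrix.mul_assoc])
      (Eventually.of_forall fun i => by
        simp only [transpose_mul, Matrix.mul_assoc, Matrix.one_mul])
  refine ((hR.trans (e1.trans e3).symm).mul_right hρ hPi).congr'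
    (Eventually.of_forall fun i => rfl) ?_
  filter_upwards [hPu] with i hi
  rw [Matrix.mul_assoc, mul_nonsing_inv _ hi, Matrix.mul_one]

/-- The rotations cancel in products of estimated factors, coefficients and loadings. -/
lemma near_common_component {T N : ℕ → ℕ} (hρ : ∀ n, 0 ≤ ρ n) (hρ0 : Tendsto ρ atTop (𝓝 0))
    {f u : ∀ n, Ω → Matrix (Fin (T n)) (Fin r) ℝ} {l : ∀ n, Matrix (Fin (N n)) (Fin r) ℝ}
    {lw : ∀ n, Ω → Matrix (Fin (N n)) (Fin r) ℝ} {C : ℕ → Ω → Matrix (Fin r) (Fin r) ℝ}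
    (hf : BddInProb μ f) (hl : BddInProb μ fun n _ => l n) (hGt : BddInProb μ Gt)
    (hHt : BddInProb μ Ht) (hGw : BddInProb μ Gw) (hHw : BddInProb μ Hw)
    (hHGt : Near μ ρ (fun n ω => Ht n ω * (Gt n ω)ᵀ) fun _ _ => 1)
    (hHGw : Near μ ρ (fun n ω => Hw n ω * (Gw n ω)ᵀ) fun _ _ => 1)
    (hu : Near μ ρ u fun n ω => f n ω * Ht n ω)
    (hC : Near μ ρ C fun n ω => (Gt n ω)ᵀ * Hw n ω)
    (hlw : Near μ ρ lw fun n ω => l n * Gw n ω) :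
    Near μ ρ (fun n ω => u n ω * C n ω * (lw n ω)ᵀ) fun n ω => f n ω * (l n)ᵀ := by
  have hGH : BddInProb μ fun n ω => (Gt n ω)ᵀ * Hw n ω := hGt.transpose.mul hHw
  have hfH : BddInProb μ fun n ω => f n ω * Ht n ω := hf.mul hHt
  have hlG : BddInProb μ fun n ω => l n * Gw n ω := hl.mul hGw
  have e1 := (hu.mul hρ hρ0 hC hfH hGH).mul hρ hρ0 hlw.transpose (hfH.mul hGH) hlG.transpose
  have hone : BddInProb μ fun (_ : ℕ) (_ : Ω) => (1 : Matrix (Fin r) (Fin r) ℝ) :=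
    BddInProb.of_tendsto tendsto_const_nhds
  -- The product regroups as `f (Ht Gtᵀ) (Hw Gwᵀ) lᵀ`, and both brackets are near the identity.
  have e2 := ((hHGt.mul hρ hρ0 hHGw hone hone).mul_left hρ hf).mul_right hρ hl.transpose
  refine e1.trans (e2.congr' (Eventually.of_forall fun i => ?_) (Eventually.of_forall fun i => ?_))
  · simp only [transpose_mul, Matrix.mul_assoc]
  · simp only [Matrix.mul_one]

end Imputation

/-- The common components imputed from two factor structures with common loadings `lo` are close
to the true ones. -/
lemma near_imputed {T To N No N₁ N₂ : ℕ → ℕ} {At Bt Aw Bw : Matrix (Fin r) (Fin r) ℝ}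
    {f : ∀ n, Ω → Matrix (Fin (T n)) (Fin r) ℝ} {fw : ∀ n, Ω → Matrix (Fin (To n)) (Fin r) ℝ}
    {lo : ∀ n, Matrix (Fin (No n)) (Fin r) ℝ} {l : ∀ n, Matrix (Fin (N n)) (Fin r) ℝ}
    {bw : ℕ → Matrix (Fin r) (Fin r) ℝ}
    {xt : ∀ n, Ω → Matrix (Fin (T n)) (Fin (N₁ n)) ℝ}
    {xw : ∀ n, Ω → Matrix (Fin (To n)) (Fin (N₂ n)) ℝ}
    {ut : ∀ n, Ω → Matrix (Fin (T n)) (Fin r) ℝ} {uw : ∀ n, Ω → Matrix (Fin (To n)) (Fin r) ℝ}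
    {dt dw : ℕ → Ω → Fin r → ℝ}
    (ht : FactorApprox μ ρ At Bt f (fun n => (lo n)ᵀ * lo n) xt ut dt)
    (hw : FactorApprox μ ρ Aw Bw fw bw xw uw dw)
    (hlo : BddInProb μ fun n _ => lo n) (hl : BddInProb μ fun n _ => l n)
    {lt lwo : ∀ n, Ω → Matrix (Fin (No n)) (Fin r) ℝ} {lw : ∀ n, Ω → Matrix (Fin (N n)) (Fin r) ℝ}
    (hlt : Near μ ρ lt fun n ω => lo n * FactorApprox.G f ut n ω)
    (hlwo : Near μ ρ lwo fun n ω => lo n * FactorApprox.G fw uw n ω)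
    (hlw : Near μ ρ lw fun n ω => l n * FactorApprox.G fw uw n ω) :
    Near μ ρ (fun n ω => ut n ω * (((lt n ω)ᵀ * lwo n ω) * ((lwo n ω)ᵀ * lwo n ω)⁻¹) * (lw n ω)ᵀ)
      fun n ω => f n ω * (l n)ᵀ := by
  have hK := (ht.bdd_G.mul ht.bdd_inv).mul ht.bdd_G.transpose
  -- The tall block supplies an approximate inverse of `loᵀ lo`: its relation `H Gᵀ ≈ 1` reads `loᵀ
  -- lo (G D⁻² Gᵀ) ≈ 1`.
  have hbK := ht.near_HG.congr' (C := fun n ω => (lo n)ᵀ * lo n * (FactorApprox.G f ut n ω *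
      (diagonal fun k => (dt n ω k ^ 2)⁻¹) * (FactorApprox.G f ut n ω)ᵀ)) (C' := fun _ _ => 1)
    (Eventually.of_forall fun i => by simp only [FactorApprox.H, Matrix.mul_assoc])
    (Eventually.of_forall fun i => rfl)
  have hC := near_regression ht.rate_nonneg ht.tendsto_rate hlo hK ht.bdd_G hw.bdd_G hw.bdd_H hbK
    hw.near_GH hw.near_HG hlt hlwo
  exact near_common_component ht.rate_nonneg ht.tendsto_rate ht.bdd_f hl ht.bdd_G ht.bdd_H hw.bdd_G
    hw.bdd_H ht.near_HG hw.near_HG ht.near_u hC hlw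

end Algebra

/-! ### The tall-wide imputation -/

section Scaling

variable {T N r : ℕ}

/-- The scaled loadings of selected units. -/
lemma IsAPC.loadings_submatrix {Y : Matrix (Fin T) (Fin N) ℝ} {Fh : Matrix (Fin T) (Fin r) ℝ}
    {Lh : Matrix (Fin N) (Fin r) ℝ} {d : Fin r → ℝ} (h : IsAPC Y Fh Lh d) (hT : 0 < T) (hN : 0 < N)
    {N' : ℕ} (g : Fin N' → Fin N) :
    (1 / √(N' : ℝ)) • Lh.submatrix g id
      = ((1 / √((N' : ℝ) * T)) • Y.submatrix id g)ᵀ * ((1 / √(T : ℝ)) • Fh) := by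
  have h1 := h.loadings hT hN
  have hN' : √(N : ℝ) ≠ 0 := by positivity
  have h2 : Lh = (1 / √(T : ℝ)) • (Yᵀ * ((1 / √(T : ℝ)) • Fh)) := by
    have h3 := congrArg (fun A => √(N : ℝ) • A) h1
    simp only [smul_smul, transpose_smul, Matrix.smul_mul] at h3
    rw [mul_one_div_cancel hN', one_smul, Real.sqrt_mul (Nat.cast_nonneg _),
      ← one_div_mul_one_div, ← mul_assoc, mul_one_div_cancel hN', one_mul] at h3
    exact h3
  rw [Real.sqrt_mul (Nat.cast_nonneg _), ← one_div_mul_one_div, transpose_smul, Matrix.smul_mul,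
    ← smul_smul]
  congr 1
  rw [h2]
  ext i k
  simp [Matrix.mul_apply]

lemma Matrix.inv_smul_of_ne_zero (A : Matrix (Fin r) (Fin r) ℝ) {c : ℝ} (hc : c ≠ 0) :
    (c • A)⁻¹ = c⁻¹ • A⁻¹ := by
  by_cases hA : IsUnit A.det
  · refine Matrix.inv_eq_right_inv ?_
    rw [Matrix.smul_mul, Matrix.mul_smul, smul_smul, mul_nonsing_inv _ hA, mul_inv_cancel₀ hc,
      one_smul]
  · have h1 : ¬ IsUnit (c • A).det := by
      rw [det_smul, isUnit_iff_ne_zero, not_not]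
      rw [isUnit_iff_ne_zero, not_not] at hA
      rw [hA, mul_zero]
    rw [nonsing_inv_apply_not_isUnit _ hA, nonsing_inv_apply_not_isUnit _ h1, smul_zero]

end Scaling

section CompleteData

variable {Ω : Type*} [MeasurableSpace Ω] {μ : Measure Ω} {r : ℕ} {ρ : ℕ → ℝ}
  {m : ℕ → FactorModel Ω r} {SF SΛ : Matrix (Fin r) (Fin r) ℝ}

/-- A factor structure observed with a small error satisfies the hypotheses of `FactorApprox`. -/
lemma AssumptionA.factorApprox_of_error (h : AssumptionA μ m SF SΛ) (hρ : ∀ n, 0 ≤ ρ n)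
    (hρ0 : Tendsto ρ atTop (𝓝 0)) {ε : ∀ n, Ω → Matrix (Fin (m n).T) (Fin (m n).N) ℝ}
    (h1 : IsBigOp μ (fun n ω => frob (ε n ω * (m n).scaledΛ)) ρ)
    (h2 : IsBigOp μ (fun n ω => frob (ε n ω * (ε n ω)ᵀ)) ρ)
    {x : ∀ n, Ω → Matrix (Fin (m n).T) (Fin (m n).N) ℝ}
    (hx : ∀ n ω, x n ω = (m n).scaledF ω * (m n).scaledΛᵀ + ε n ω)
    {u : ∀ n, Ω → Matrix (Fin (m n).T) (Fin r) ℝ} {d : ℕ → Ω → Fin r → ℝ}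
    (hpc : ∀ᶠ n in atTop, ∀ ω, IsPC (x n ω) (u n ω) (d n ω)) :
    FactorApprox μ ρ SF SΛ (fun n ω => (m n).scaledF ω)
      (fun n => (m n).scaledΛᵀ * (m n).scaledΛ) x u d where
  rate_nonneg := hρ
  tendsto_rate := hρ0
  posDef_A := h.posDef_F
  posDef_B := h.posDef_Λ
  tendsto_f := h.tendsto_scaledF
  tendsto_b := h.tendsto_scaledΛ
  isPC := hpc
  approx := by
    have h3 := near_of_error hρ h.bdd_scaledF h1 h2
    exact h3.congr' (Eventually.of_forall fun i => by simp only [hx])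
      (Eventually.of_forall fun i => rfl)

/-- Principal components of complete data. -/
lemma AssumptionA.factorApprox [IsProbabilityMeasure μ] (h : AssumptionA μ m SF SΛ)
    (hρ : ∀ n, 0 ≤ ρ n) (hρ0 : Tendsto ρ atTop (𝓝 0)) (hT : DominatesInv ρ fun n => (m n).T)
    (hN : DominatesInv ρ fun n => (m n).N) {Fh : ∀ n, Ω → Matrix (Fin (m n).T) (Fin r) ℝ}
    {Lh : ∀ n, Ω → Matrix (Fin (m n).N) (Fin r) ℝ} {d : ℕ → Ω → Fin r → ℝ}
    (hapc : ∀ n ω, IsAPC ((m n).X ω) (Fh n ω) (Lh n ω) (d n ω)) :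
    FactorApprox μ ρ SF SΛ (fun n ω => (m n).scaledF ω)
      (fun n => (m n).scaledΛᵀ * (m n).scaledΛ)
      (fun n ω => (1 / √(((m n).N : ℝ) * (m n).T)) • (m n).X ω)
      (fun n ω => (1 / √((m n).T : ℝ)) • Fh n ω) d := by
  obtain ⟨M, hM⟩ := h.moments
  -- Complete data are the case in which the mask hides nothing.
  have e1 := bigOp_mask_scaledE_mul_scaledΛ hM hρ hT hN fun _ _ _ => true
  have e2 := bigOp_mask_scaledE_mul_transpose (K := |1 + M|) hM hρ hT hN (fun _ _ _ => true)
    (abs_nonneg _) (by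
      filter_upwards [hN] with n hn t s
      refine ((hM n).integral_centred_sq_le (c := (m n).N) (Nat.cast_pos.2 hn.1) _ t s ?_).trans
        (mul_le_mul_of_nonneg_right (le_abs_self _) (Nat.cast_nonneg _))
      simpa using (hM n).fourth t s)
  simp only [maskMatrix_true] at e1 e2
  refine h.factorApprox_of_error hρ hρ0 e1 e2 (fun n ω => (m n).scaledX_eq ω) ?_
  filter_upwards [hT] with n hn ω
  exact (hapc n ω).isPC hn.1

end CompleteData

namespace Panel

variable {Ω : Type*} {r : ℕ} (p : Panel Ω r)

lemma sum_units_observed (g : Fin p.N → ℝ) :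
    ∑ i with i.val < p.No, g i = ∑ i : Fin p.No, g (p.unitO i) := by
  refine (Finset.sum_nbij (fun i : Fin p.No => p.unitO i) ?_ ?_ ?_ fun _ _ => rfl).symm
  · intro i _
    simp [unitO]
  · intro i _ j _ hij
    exact Fin.castLE_injective p.No_le hij
  · intro i hi
    simp only [Finset.coe_filter, Finset.mem_univ, true_and, Set.mem_ofPred_eq] at hi
    exact ⟨⟨i.val, hi⟩, by simp, rfl⟩

end Panel

/-! ### Errors of the units observed in both of two periods. -/

section Masked

variable {Ω : Type*} [MeasurableSpace Ω] {μ : Measure Ω} [IsProbabilityMeasure μ] {r : ℕ}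

/-- Second moments of the centred sums of products of errors over the commonly observed units. -/
lemma Panel.integral_observed_sq_le {p : Panel Ω r} {M₁ M₂ M₃ : ℝ}
    (hp : MomentBounds μ M₁ p.toFactorModel) (ht : MomentBounds μ M₂ p.tall) (hNo : 0 < p.No)
    (hobs : ∀ t s : Fin p.T, p.To ≤ s.val →
      ∫ ω, |(1 / √(p.N : ℝ)) *
        ∑ i with p.No ≤ i.val ∧ p.obs t i = true ∧ p.obs s i = true,
          (p.e ω s i * p.e ω t i - ∫ ω', p.e ω' s i * p.e ω' t i ∂μ)| ^ 4 ∂μ ≤ M₃)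
    (t s : Fin p.T) :
    ∫ ω, (∑ i with p.obs t i = true ∧ p.obs s i = true,
      (p.e ω s i * p.e ω t i - ∫ ω', p.e ω' s i * p.e ω' t i ∂μ)) ^ 2 ∂μ ≤
      (|1 + M₁| + (2 * |1 + M₂| + 2 * |1 + M₃|)) * p.N := by
  have hN : 0 < p.N := hNo.trans_le p.No_le
  have hN' : (0 : ℝ) < p.N := Nat.cast_pos.2 hN
  have main : ∀ t s : Fin p.T, p.To ≤ s.val →
      ∫ ω, (∑ i with p.obs t i = true ∧ p.obs s i = true,
        (p.e ω s i * p.e ω t i - ∫ ω', p.e ω' s i * p.e ω' t i ∂μ)) ^ 2 ∂μ ≤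
        (2 * |1 + M₂| + 2 * |1 + M₃|) * p.N := by
    intro t s hs
    set a : Ω → Fin p.N → ℝ := fun ω i =>
      p.e ω s i * p.e ω t i - ∫ ω', p.e ω' s i * p.e ω' t i ∂μ with ha
    have hmem : ∀ I : Finset (Fin p.N), MemLp (fun ω => ∑ i ∈ I, a ω i) 2 μ := fun I =>
      memLp_finsetSum _ fun i _ =>
        ((hp.memLp_e_mul s i t i).mono_exponent (by norm_num)).sub (memLp_const _)
    -- The first `No` units are observed in every period and are handled by the fourth moments of
    -- the tall block; the remaining commonly observed units are handled by the additional condition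
    -- of Assumption B.
    have hsplit : ∀ ω, ∑ i with p.obs t i = true ∧ p.obs s i = true, a ω i
        = ∑ i with i.val < p.No, a ω i +
          ∑ i with p.No ≤ i.val ∧ p.obs t i = true ∧ p.obs s i = true, a ω i := by
      intro ω
      rw [← Finset.sum_filter_add_sum_filter_not _ (fun i : Fin p.N => i.val < p.No),
        Finset.filter_filter, Finset.filter_filter]
      congr 1
      · refine Finset.sum_congr (Finset.filter_congr fun i _ => ?_) fun _ _ => rfl
        exact ⟨fun h => h.2, fun h => ⟨⟨p.obs_tall t i h, p.obs_tall s i h⟩, h⟩⟩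
      · refine Finset.sum_congr (Finset.filter_congr fun i _ => ?_) fun _ _ => rfl
        rw [not_lt]
        exact and_comm
    have h1 : ∫ ω, (∑ i with i.val < p.No, a ω i) ^ 2 ∂μ ≤ (1 + M₂) * p.No := by
      simp only [p.sum_units_observed]
      exact ht.integral_centred_sq_le (c := p.No) (Nat.cast_pos.2 hNo) Finset.univ t s
        (ht.fourth t s)
    have h2 := hp.integral_centred_sq_le hN' _ t s (hobs t s hs)
    have i1 := (hmem (Finset.univ.filter fun i => i.val < p.No)).integrable_sq
    have i2 := (hmem (Finset.univ.filter fun i =>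
      p.No ≤ i.val ∧ p.obs t i = true ∧ p.obs s i = true)).integrable_sq
    calc _ ≤ ∫ ω, (2 * (∑ i with i.val < p.No, a ω i) ^ 2 +
          2 * (∑ i with p.No ≤ i.val ∧ p.obs t i = true ∧ p.obs s i = true, a ω i) ^ 2) ∂μ := by
          refine integral_mono (hmem _).integrable_sq
            ((i1.const_mul 2).add (i2.const_mul 2)) fun ω => ?_
          change (∑ i with p.obs t i = true ∧ p.obs s i = true, a ω i) ^ 2 ≤ _
          rw [hsplit]
          exact add_sq_le.trans_eq (mul_add _ _ _)
      _ = 2 * ∫ ω, (∑ i with i.val < p.No, a ω i) ^ 2 ∂μ + 2 * ∫ ω,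
          (∑ i with p.No ≤ i.val ∧ p.obs t i = true ∧ p.obs s i = true, a ω i) ^ 2 ∂μ := by
          rw [integral_add (i1.const_mul 2) (i2.const_mul 2), integral_const_mul,
            integral_const_mul]
      _ ≤ 2 * (|1 + M₂| * p.N) + 2 * (|1 + M₃| * p.N) := by
          have h3 : (1 + M₂) * p.No ≤ |1 + M₂| * p.N :=
            mul_le_mul (le_abs_self _) (Nat.cast_le.2 p.No_le) (Nat.cast_nonneg _) (abs_nonneg _)
          have h4 : (1 + M₃) * p.N ≤ |1 + M₃| * p.N :=
            mul_le_mul_of_nonneg_right (le_abs_self _) hN'.le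
          linarith [h1, h2]
      _ = _ := by ring
  have hle : (2 * |1 + M₂| + 2 * |1 + M₃|) * p.N ≤
      (|1 + M₁| + (2 * |1 + M₂| + 2 * |1 + M₃|)) * p.N := by
    have := mul_nonneg (abs_nonneg (1 + M₁)) hN'.le
    linarith
  -- The additional condition concerns late `s`; a late `t` follows by symmetry. If both periods are
  -- among the first `To`, all units are observed and the full panel's condition applies.
  rcases le_or_gt p.To s.val with hs | hs
  · exact (main t s hs).trans hle
  rcases le_or_gt p.To t.val with ht' | ht'
  · have := main s t ht'
    simp only [and_comm, mul_comm (p.e _ t _)] at this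
    exact this.trans hle
  · have h1 : (Finset.univ.filter fun i => p.obs t i = true ∧ p.obs s i = true) = Finset.univ :=
      Finset.filter_true_of_mem fun i _ => ⟨p.obs_wide t i ht', p.obs_wide s i hs⟩
    rw [h1]
    refine (hp.integral_centred_sq_le hN' _ t s (hp.fourth t s)).trans ?_
    refine mul_le_mul_of_nonneg_right ((le_abs_self _).trans ?_) hN'.le
    linarith [abs_nonneg (1 + M₂), abs_nonneg (1 + M₃)]

end Masked

namespace TallWide

variable {Ω : Type*} {r : ℕ} {p : Panel Ω r} {ω : Ω} (q : TallWide p ω)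

/-- The regression coefficients do not change when the loadings are rescaled. -/
lemma Hmiss_eq {c : ℝ} (hc : c ≠ 0) :
    q.Hmiss = ((c • q.Λtall)ᵀ * (c • q.Λwo)) * ((c • q.Λwo)ᵀ * (c • q.Λwo))⁻¹ := by
  have hcc : c * c ≠ 0 := mul_ne_zero hc hc
  simp only [transpose_smul, Matrix.smul_mul, Matrix.mul_smul, smul_smul]
  rw [Matrix.inv_smul_of_ne_zero _ hcc, Matrix.mul_smul, smul_smul, mul_inv_cancel₀ hcc, one_smul,
    Hmiss]

lemma scaledC_eq (hNo : 0 < p.No) :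
    (1 / √((p.N : ℝ) * p.T)) • q.C = ((1 / √(p.T : ℝ)) • q.Ftall) *
      ((((1 / √(p.No : ℝ)) • q.Λtall)ᵀ * ((1 / √(p.No : ℝ)) • q.Λwo)) *
      (((1 / √(p.No : ℝ)) • q.Λwo)ᵀ * ((1 / √(p.No : ℝ)) • q.Λwo))⁻¹) *
      ((1 / √(p.N : ℝ)) • q.Λwide)ᵀ := by
  have hc : (1 / √(p.No : ℝ)) ≠ 0 := by positivity
  rw [← q.Hmiss_eq hc, C, transpose_smul, Matrix.smul_mul, Matrix.smul_mul, Matrix.mul_smul,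
    smul_smul, Real.sqrt_mul (Nat.cast_nonneg _), mul_comm √(p.N : ℝ), ← one_div_mul_one_div]

/-- The imputed matrix as a factor structure with error. -/
lemma scaled_imputed_eq :
    (1 / √((p.N : ℝ) * p.T)) • q.imputed = p.scaledF ω * p.scaledΛᵀ +
      (maskMatrix p.obs (p.scaledE ω) + maskMatrix (fun t i => !p.obs t i)
        ((1 / √((p.N : ℝ) * p.T)) • q.C - p.scaledF ω * p.scaledΛᵀ)) := by
  have h1 := p.scaledX_eq ω
  ext t i
  have h2 := congrFun (congrFun h1 t) i
  simp only [Matrix.smul_apply, Matrix.add_apply, smul_eq_mul] at h2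
  simp only [Matrix.smul_apply, Matrix.add_apply, smul_eq_mul, imputed, maskMatrix, of_apply,
    Matrix.sub_apply]
  by_cases ho : p.obs t i = true
  · simp only [ho, if_true, h2, Bool.not_true, Bool.false_eq_true, if_false, add_zero]
  · simp [ho]

end TallWide

section SelectedLoadings

variable {Ω : Type*} [MeasurableSpace Ω] {μ : Measure Ω} [IsProbabilityMeasure μ] {r : ℕ}
  {ρ : ℕ → ℝ} {m : ℕ → FactorModel Ω r} {SF SΛ : Matrix (Fin r) (Fin r) ℝ}

/-- The estimated loadings of selected units. -/
lemma AssumptionA.near_selected_loadings (h : AssumptionA μ m SF SΛ) (hρ : ∀ n, 0 ≤ ρ n)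
    (hρ0 : Tendsto ρ atTop (𝓝 0)) (hT : DominatesInv ρ fun n => (m n).T)
    (hN : DominatesInv ρ fun n => (m n).N) {Fh : ∀ n, Ω → Matrix (Fin (m n).T) (Fin r) ℝ}
    {Lh : ∀ n, Ω → Matrix (Fin (m n).N) (Fin r) ℝ} {d : ℕ → Ω → Fin r → ℝ}
    (hapc : ∀ n ω, IsAPC ((m n).X ω) (Fh n ω) (Lh n ω) (d n ω)) {N' : ℕ → ℕ}
    (hN' : DominatesInv ρ N') (g : ∀ n, Fin (N' n) → Fin (m n).N) {M : ℝ}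
    (hM : ∀ n, MomentBounds μ M ((m n).sub id (g n))) :
    Near μ ρ (fun n ω => (1 / √(N' n : ℝ)) • (Lh n ω).submatrix (g n) id)
      fun n ω => ((1 / √(N' n : ℝ)) • (m n).Λ.submatrix (g n) id) *
        FactorApprox.G (fun n ω => (m n).scaledF ω)
          (fun n ω => (1 / √((m n).T : ℝ)) • Fh n ω) n ω := by
  -- The errors are normalised by the number of selected units, so that they are the scaled errors
  -- of the selected block, a factor model with its own moment bounds.
  let ε : ∀ n, Ω → Matrix (Fin (m n).T) (Fin (N' n)) ℝ := fun n ω =>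
    (1 / √((N' n : ℝ) * (m n).T)) • ((m n).e ω).submatrix id (g n)
  have hε : BddInProb μ ε :=
    bddInProb_scaledE (m := fun n => (m n).sub id (g n)) hM
  have hεf : IsBigOp μ (fun n ω => frob ((ε n ω)ᵀ * (m n).scaledF ω)) ρ :=
    bigOp_scaledE_transpose_mul_scaledF (m := fun n => (m n).sub id (g n)) hM hρ hT hN'
  have hx : ∀ n ω, (1 / √((N' n : ℝ) * (m n).T)) • ((m n).X ω).submatrix id (g n)
      = (m n).scaledF ω * ((1 / √(N' n : ℝ)) • (m n).Λ.submatrix (g n) id)ᵀ + ε n ω :=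
    fun n ω => ((m n).sub id (g n)).scaledX_eq ω
  refine ((h.factorApprox hρ hρ0 hT hN hapc).near_loadings hε hεf).congr_left ?_
  filter_upwards [hT, hN] with n h2 h3 ω
  rw [(hapc n ω).loadings_submatrix h2.1 h3.1 (g n), hx]

end SelectedLoadings

/-! ### The imputed panel as an approximate factor structure. -/

section Imputation

variable {Ω : Type*} [MeasurableSpace Ω] {μ : Measure Ω} [IsProbabilityMeasure μ] {r : ℕ}
  {p : ℕ → Panel Ω r} {ρ : ℕ → ℝ}

/-- The imputed common components are close to the true ones. -/
lemma near_scaledC (hρ : ∀ n, 0 ≤ ρ n) (hρ0 : Tendsto ρ atTop (𝓝 0))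
    (hT : DominatesInv ρ fun n => (p n).T) (hN : DominatesInv ρ fun n => (p n).N)
    (hTo : DominatesInv ρ fun n => (p n).To) (hNo : DominatesInv ρ fun n => (p n).No)
    (hB : AssumptionB μ p) (q : ∀ n ω, TallWide (p n) ω) :
    Near μ ρ (fun n ω => (1 / √(((p n).N : ℝ) * (p n).T)) • (q n ω).C)
      fun n ω => (p n).scaledF ω * (p n).scaledΛᵀ := by
  obtain ⟨_, _, hbal⟩ := hB.bal
  obtain ⟨_, _, htall⟩ := hB.tall
  obtain ⟨_, _, hwide⟩ := hB.wide
  obtain ⟨Mb, hMb⟩ := hbal.moments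
  obtain ⟨Mt, hMt⟩ := htall.moments
  obtain ⟨Mw, hMw⟩ := hwide.moments
  have ht := fun n ω => (q n ω).isAPC_tall
  have hw := fun n ω => (q n ω).isAPC_wide
  have hlt := htall.near_selected_loadings hρ hρ0 hT hNo ht hNo (fun _ => id) hMt
  have hlw := hwide.near_selected_loadings hρ hρ0 hTo hN hw hN (fun _ => id) hMw
  -- The wide block restricted to the first `No` units is the balanced block; its moment bounds
  -- enter here.
  have hlwo := hwide.near_selected_loadings hρ hρ0 hTo hN hw hNo (fun n => (p n).unitO) hMb
  have key := near_imputed (htall.factorApprox hρ hρ0 hT hNo ht)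
    (hwide.factorApprox hρ hρ0 hTo hN hw) htall.bdd_scaledΛ hwide.bdd_scaledΛ hlt hlwo hlw
  refine key.congr_left ?_
  filter_upwards [hNo] with n h1 ω
  exact ((q n ω).scaledC_eq h1.1).symm

/-- Principal components of the imputed data. -/
lemma factorApprox_imputed (hρ : ∀ n, 0 ≤ ρ n) (hρ0 : Tendsto ρ atTop (𝓝 0))
    (hT : DominatesInv ρ fun n => (p n).T) (hN : DominatesInv ρ fun n => (p n).N)
    (hTo : DominatesInv ρ fun n => (p n).To) (hNo : DominatesInv ρ fun n => (p n).No)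
    {SF SΛ : Matrix (Fin r) (Fin r) ℝ} (hA : AssumptionA μ (fun n => (p n).toFactorModel) SF SΛ)
    (hB : AssumptionB μ p) (q : ∀ n ω, ReEstimate (p n) ω) :
    FactorApprox μ ρ SF SΛ (fun n ω => (p n).scaledF ω)
      (fun n => (p n).scaledΛᵀ * (p n).scaledΛ)
      (fun n ω => (1 / √(((p n).N : ℝ) * (p n).T)) • (q n ω).imputed)
      (fun n ω => (1 / √((p n).T : ℝ)) • (q n ω).Fplus) (fun n ω => (q n ω).dplus) := by
  obtain ⟨M₁, hM₁⟩ := hA.moments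
  obtain ⟨_, _, htall⟩ := hB.tall
  obtain ⟨M₂, hM₂⟩ := htall.moments
  obtain ⟨M₃, hM₃⟩ := hB.fourth_obs
  have e1 := bigOp_mask_scaledE_mul_scaledΛ hM₁ hρ hT hN fun n => (p n).obs
  have e2 := bigOp_mask_scaledE_mul_transpose (K := |1 + M₁| + (2 * |1 + M₂| + 2 * |1 + M₃|))
    hM₁ hρ hT hN (fun n => (p n).obs) (by positivity) (by
      filter_upwards [hNo] with n hn t s
      exact Panel.integral_observed_sq_le (hM₁ n) (hM₂ n) hn.1 (hM₃ n) t s)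
  have e3 : BddInProb μ fun n ω => maskMatrix (p n).obs ((p n).scaledE ω) :=
    IsBigOp.frob_le (bddInProb_scaledE hM₁)
      (Eventually.of_forall fun i => frob_maskMatrix_le _ _)
  have e4 : IsBigOp μ (fun n ω => frob (maskMatrix (fun t i => !(p n).obs t i)
      ((1 / √(((p n).N : ℝ) * (p n).T)) • (q n ω).C - (p n).scaledF ω * (p n).scaledΛᵀ))) ρ :=
    IsBigOp.frob_le (near_scaledC hρ hρ0 hT hN hTo hNo hB fun n ω => (q n ω).toTallWide)
      (Eventually.of_forall fun i => frob_maskMatrix_le _ _)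
  have e5 : BddInProb μ fun n ω => maskMatrix (fun t i => !(p n).obs t i)
      ((1 / √(((p n).N : ℝ) * (p n).T)) • (q n ω).C - (p n).scaledF ω * (p n).scaledΛᵀ) :=
    IsBigOp.bdd hρ hρ0 e4
  -- The imputation error is itself `O_p(ρ)` in Frobenius norm, so every product of it with a
  -- bounded factor is. The masked errors are only bounded; for them the moment estimates `e1` and
  -- `e2` are indispensable.
  have e6 := IsBigOp.frob_mul_right hρ e4 e3.transpose
  refine hA.factorApprox_of_error hρ hρ0 ?_ ?_ (fun n ω => (q n ω).scaled_imputed_eq) ?_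
  · refine (e1.frob_add (IsBigOp.frob_mul_right hρ e4 hA.bdd_scaledΛ)).frob_le
      (Eventually.of_forall fun i => le_of_eq ?_)
    rw [Matrix.add_mul]
  · refine (((e2.frob_add e6).frob_add e6.frob_transpose).frob_add
      (IsBigOp.frob_mul_right hρ e4 e5.transpose)).frob_le
      (Eventually.of_forall fun i => le_of_eq ?_)
    congr 1
    simp only [transpose_add, transpose_mul, transpose_transpose, Matrix.add_mul, Matrix.mul_add]
    abel
  · filter_upwards [hT] with n hn ω
    exact (q n ω).isAPC_plus.isPC hn.1

end Imputation

namespace ReEstimate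

variable {Ω : Type*} {r : ℕ} {p : Panel Ω r} {ω : Ω} (q : ReEstimate p ω)

/-- The mean squared distance of the factors as a Frobenius norm. -/
lemma mean_sq_eq : (1 / (p.T : ℝ)) *
    ∑ t, euclNorm (q.Fplus t - q.Hplusᵀ *ᵥ p.F ω t) ^ 2
    = frob ((1 / √(p.T : ℝ)) • q.Fplus - p.scaledF ω * q.Hplus) ^ 2 := by
  have h1 : (1 / √(p.T : ℝ)) • q.Fplus - p.scaledF ω * q.Hplus
      = (1 / √(p.T : ℝ)) • (q.Fplus - p.F ω * q.Hplus) := by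
    rw [FactorModel.scaledF, Matrix.smul_mul, smul_sub]
  rw [h1, frob_smul, mul_pow, sq_abs, sq (1 / √(p.T : ℝ)), FactorModel.one_div_sqrt_mul_self,
    frob_sq]
  congr 1
  refine Finset.sum_congr rfl fun t _ => ?_
  rw [euclNorm_sq]
  refine Finset.sum_congr rfl fun k _ => ?_
  simp only [Pi.sub_apply, Matrix.sub_apply, mulVec, dotProduct, transpose_apply, Matrix.mul_apply]
  congr 2
  exact Finset.sum_congr rfl fun j _ => mul_comm _ _

end ReEstimate

/-- The two factors `1/√T`, from `f` and from `u`, combine to the `1/T` of `H⁺`, and likewise for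
the loadings. -/
lemma FactorApprox.H_imputed {Ω : Type*} {r : ℕ} {p : ℕ → Panel Ω r}
    (q : ∀ n ω, ReEstimate (p n) ω) (n : ℕ) (ω : Ω) :
    FactorApprox.H (fun n ω => (p n).scaledF ω) (fun n => (p n).scaledΛᵀ * (p n).scaledΛ)
      (fun n ω => (1 / √((p n).T : ℝ)) • (q n ω).Fplus) (fun n ω => (q n ω).dplus) n ω
      = (q n ω).Hplus := by
  simp only [FactorApprox.H, FactorApprox.G, ReEstimate.Hplus, FactorModel.scaledF,
    FactorModel.scaledΛ, transpose_smul]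
  rw [Matrix.smul_mul, Matrix.mul_smul, smul_smul, FactorModel.one_div_sqrt_mul_self,
    Matrix.smul_mul (1 / √((p n).T : ℝ)) ((p n).F ω)ᵀ, Matrix.mul_smul ((p n).F ω)ᵀ, smul_smul,
    FactorModel.one_div_sqrt_mul_self]

/-! ### Rates and limits of the re-estimated factors. -/

theorem lemma3 {Ω : Type*} [MeasurableSpace Ω] (μ : Measure Ω) [IsProbabilityMeasure μ]
    {r : ℕ} (p : ℕ → Panel Ω r)
    (hNo : Tendsto (fun n => (p n).No) atTop atTop)
    (hTo : Tendsto (fun n => (p n).To) atTop atTop)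
    (SF SΛ : Matrix (Fin r) (Fin r) ℝ)
    (hA : AssumptionA μ (fun n => (p n).toFactorModel) SF SΛ)
    (hB : AssumptionB μ p)
    (q : ∀ n ω, ReEstimate (p n) ω)
    (v : Fin r → ℝ) (Q : Matrix (Fin r) (Fin r) ℝ) (hQ : IsCompleteDataLimit SF SΛ v Q) :
    IsBigOp μ
      (fun n ω => (1 / ((p n).T : ℝ)) *
        ∑ t, euclNorm ((q n ω).Fplus t - (q n ω).Hplusᵀ *ᵥ (p n).F ω t) ^ 2)
      (fun n => 1 / ((min (p n).No (p n).To : ℕ) : ℝ)) ∧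
    TendstoInProb μ (fun n ω => diagonal fun k => (q n ω).dplus k ^ 2) (diagonal v) ∧
    ∃ s : ℕ → Ω → Fin r → ℝ, (∀ n ω k, s n ω k = 1 ∨ s n ω k = -1) ∧
      TendstoInProb μ
        (fun n ω => diagonal (s n ω) *
          ((1 / ((p n).T : ℝ)) • ((q n ω).Fplusᵀ * (p n).F ω))) Q := by
  -- The Frobenius distance of `u` from `f H` is `O_p(ρ)`, and the mean square in (i) is its square;
  -- hence `ρ²` is chosen as the target rate.
  set ρ : ℕ → ℝ := fun n => 1 / √((min (p n).No (p n).To : ℕ) : ℝ) with hρdef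
  have hρ : ∀ n, 0 ≤ ρ n := fun n => by positivity
  have hmin : Tendsto (fun n => min (p n).No (p n).To) atTop atTop :=
    tendsto_atTop.2 fun c => by
      filter_upwards [tendsto_atTop.1 hNo c, tendsto_atTop.1 hTo c] with n h1 h2
      exact le_min h1 h2
  have hρ0 : Tendsto ρ atTop (𝓝 0) := by
    have h1 := Real.tendsto_sqrt_atTop.comp (tendsto_natCast_atTop_atTop (R := ℝ) |>.comp hmin)
    exact h1.inv_tendsto_atTop.congr fun n => by
      simp only [hρdef, one_div, Pi.inv_apply, Function.comp]
  have hρρ : ∀ n, ρ n * ρ n = 1 / ((min (p n).No (p n).To : ℕ) : ℝ) := fun n =>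
    FactorModel.one_div_sqrt_mul_self _
  -- Each of `T`, `N`, `To`, `No` is at least the minimum, so a single rate serves the full panel
  -- and all blocks.
  have hdom : ∀ S : ℕ → ℕ, (∀ n, min (p n).No (p n).To ≤ S n) → DominatesInv ρ S := by
    intro S hS
    filter_upwards [tendsto_atTop.1 hmin 1] with n hn
    refine ⟨lt_of_lt_of_le hn (hS n), ?_⟩
    rw [sq, hρρ]
    exact one_div_le_one_div_of_le (Nat.cast_pos.2 hn) (Nat.cast_le.2 (hS n))
  have h := factorApprox_imputed hρ hρ0
    (hdom _ fun n => (min_le_right _ _).trans (p n).To_le)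
    (hdom _ fun n => (min_le_left _ _).trans (p n).No_le)
    (hdom _ fun n => min_le_right _ _) (hdom _ fun n => min_le_left _ _) hA hB q
  refine ⟨?_, tendstoInProb_iff_probFilter.2 (h.tendsto_singularValues hA.distinct hQ), ?_⟩
  · have h1 := IsBigOp.mul hρ hρ h.near_u h.near_u
    simp only [hρρ] at h1
    refine h1.mono (Eventually.of_forall fun i => le_of_eq ?_)
    simp only [(q i.1 i.2).mean_sq_eq, FactorApprox.H_imputed]
    rw [sq]
  · obtain ⟨s, hs, hsQ⟩ := h.exists_signs hA.distinct hQ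
    refine ⟨fun n ω => s (n, ω), fun n ω => hs (n, ω), tendstoInProb_iff_probFilter.2 ?_⟩
    refine hsQ.congr fun i => ?_
    rw [FactorApprox.G, transpose_mul, transpose_transpose, FactorModel.scaledF, transpose_smul,
      Matrix.smul_mul, Matrix.mul_smul (q i.1 i.2).Fplusᵀ, smul_smul,
      FactorModel.one_div_sqrt_mul_self]
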